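/- **Setting.** Let $M$ be a multiset of subsets of $[n]$, and let $k\ge 1$. In Maximum Coverage (respectively Unique Coverage) one has to choose at most $k$ of the sets of $M$ so that the number of elements of $[n]$ that belong to at least one (respectively exactly one) of the chosen sets is maximized. An insertion-deletion stream starts from the empty collection and is a finite sequence, of any length, of updates; each update inserts a subset of $[n]$ or deletes a set that is currently present. The collection $M$ to be solved is the one that is present at the end of the stream. We consider streams in which every inserted set has size at most $d$ and in which at most $m$ sets (counted with multiplicity) are present at any time. A randomized single-pass algorithm using $s$ bits of space reads the updates once and in order, each update being one item of the stream; between two updates it keeps only $s$ bits (random choices that are to be used again are part of these bits), and at the end it outputs a collection of sets computed from these bits. It may use random choices in every step, and it may depend on $n$, $m$, $k$, $d$ (and on the exponent $\gamma$ below). **Theorem.** For every $\gamma\in\mathbb N$ there are constants $K$ and $e$, depending only on $\gamma$, such that for all integers $n,d\ge 0$ and $1\le k\le m$ there are two randomized single-pass algorithms, one for Maximum Coverage and one for Unique Coverage, each using at most $$K\, d^{2d}k^d\,\bigl(\log(n+m+2)\bigr)^{e}$$ bits of space, that is, $\tilde O(d^{2d}k^d)$ bits (with $0^0=1$), with the following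 property. For every insertion-deletion stream as above, the algorithm outputs an exact optimal solution (at most $k$ of the sets present at the end of the stream, with the maximum possible objective value) with probability at least $1-(m+1)^{-\gamma}$. -/

import Mathlib

open scoped ENNReal

/-- One item of an insertion-deletion stream of subsets of a universe of `n` elements. -/
inductive SetUpdate (n : ℕ) where
  | insert (S : Finset (Fin n)) : SetUpdate n
  | delete (S : Finset (Fin n)) : SetUpdate n

/-- The collection of sets after processing one update. Collections are multisets, so that, as for
an indexed family `S₁, …, Sₘ`, the same set may be present several times. -/
def SetUpdate.apply {n : ℕ} (M : Multiset (Finset (Fin n))) :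
    SetUpdate n → Multiset (Finset (Fin n))
  | .insert S => S ::ₘ M
  | .delete S => M.erase S

/-- The collection of sets left at the end of a stream that starts from the empty collection. -/
def finalCollection {n : ℕ} (us : List (SetUpdate n)) : Multiset (Finset (Fin n)) :=
  us.foldl SetUpdate.apply 0

/-- Starting from the collection `M`, the stream inserts only sets of size at most `d`, deletes only
sets that are present, and never has more than `m` sets (with multiplicity) present after an
insertion. The length of the stream is not restricted. -/
def IsValidStreamFrom {n : ℕ} (m d : ℕ) :
    Multiset (Finset (Fin n)) → List (SetUpdate n) → Prop
  | _, [] => True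
  | M, .insert S :: us =>
      S.card ≤ d ∧ (S ::ₘ M).card ≤ m ∧ IsValidStreamFrom m d (S ::ₘ M) us
  | M, .delete S :: us => S ∈ M ∧ IsValidStreamFrom m d (M.erase S) us

/-- A valid insertion-deletion stream, starting from the empty collection. -/
def IsValidStream {n : ℕ} (m d : ℕ) (us : List (SetUpdate n)) : Prop :=
  IsValidStreamFrom m d 0 us

/-- The number of elements that belong to at least one set of the collection. -/
def coverage {n : ℕ} (C : Multiset (Finset (Fin n))) : ℕ :=
  (Finset.univ.filter fun x : Fin n => 1 ≤ C.countP fun S => x ∈ S).card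

/-- The number of elements that belong to exactly one set of the collection. -/
def uniqueCoverage {n : ℕ} (C : Multiset (Finset (Fin n))) : ℕ :=
  (Finset.univ.filter fun x : Fin n => C.countP (fun S => x ∈ S) = 1).card

/-- `C` consists of at most `k` of the sets of `M`, and maximizes `value` among all such choices. -/
def IsOptimalSolution {n : ℕ} (value : Multiset (Finset (Fin n)) → ℕ) (k : ℕ)
    (M C : Multiset (Finset (Fin n))) : Prop :=
  C ≤ M ∧ C.card ≤ k ∧ ∀ C' : Multiset (Finset (Fin n)), C' ≤ M → C'.card ≤ k → value C' ≤ value C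

/-- A randomized single-pass algorithm with `s` bits of memory for streams of set updates. Nothing
but the content of the memory is carried from one update to the next: in particular, random choices
that are used again later (such as hash functions) occupy memory. -/
structure StreamingAlgorithm (n s : ℕ) where
  /-- The random initial content of the memory. -/
  init : PMF (Fin s → Bool)
  /-- The random new content of the memory after reading one update. -/
  step : (Fin s → Bool) → SetUpdate n → PMF (Fin s → Bool)
  /-- The random answer computed from the memory at the end of the stream. -/
  output : (Fin s → Bool) → PMF (Multiset (Finset (Fin n)))

namespace StreamingAlgorithm

/-- The distribution of the memory after reading the given updates from the given memory. -/
noncomputable def runFrom {n s : ℕ} (A : StreamingAlgorithm n s) :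
    (Fin s → Bool) → List (SetUpdate n) → PMF (Fin s → Bool)
  | σ, [] => PMF.pure σ
  | σ, u :: us => (A.step σ u).bind fun σ' => A.runFrom σ' us

/-- The distribution of the answer of the algorithm on a stream. -/
noncomputable def result {n s : ℕ} (A : StreamingAlgorithm n s) (us : List (SetUpdate n)) :
    PMF (Multiset (Finset (Fin n))) :=
  (A.init.bind fun σ => A.runFrom σ us).bind A.output

/-- On every valid stream, the probability that the answer is not an optimal choice of at most `k`
of the sets present at the end of the stream is at most `δ`. -/
def SolvesExactly {n s : ℕ} (A : StreamingAlgorithm n s)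
    (value : Multiset (Finset (Fin n)) → ℕ) (m d k : ℕ) (δ : ℝ≥0∞) : Prop :=
  ∀ us : List (SetUpdate n), IsValidStream m d us →
    (A.result us).toOuterMeasure
      {C | ¬ IsOptimalSolution value k (finalCollection us) C} ≤ δ

end StreamingAlgorithm

/-! The sketch is additive over the sets of the collection, so a deletion subtracts what the
insertion added, and only the final collection `M` matters, not the length of the stream.

Colour the universe at random with `2kd²` colours. For a fixed optimal solution `C` and `S ∈ C`,
with probability at least 1/2 no colour of `S` occurs on the rest of the union of `C`. Every set of
`M` with the size and colour set of `S` then meets that union only inside `S`, so it can replace `S`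
without loss; `countingValue_le_exchange` shows this for both objectives. To decide which set of
such a bucket to look for, sets receive random priorities, and `C` is an optimal solution with least
sum of priorities. Then `S` has least priority in its bucket
(`exists_finset_isOptimalSolution_rank_minimal`). Since `C` depends only on the priorities, the
colourings remain independent of it.

A bucket may be large, so it is thinned by priority thresholds `2^(J-j)`. With high probability some
level leaves at least one and at most `5a` sets, and `S`, having least priority, is among them. The
vector of multiplicities at that level is sparse, hence determined by a few random linear
functionals modulo `m+1`, by a union bound over all sparse vectors. The decoded sets all belong to
`M` and include `C`, so the best choice among them is optimal (`isOptimalSolution_of_sketch`).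

The priorities, colourings and functionals are too large to store. As in Newman's theorem, a short
list of seeds fixed in advance works for all `M`, and only an index into the list is kept
(`exists_sample_of_uniformProb_le`). The space is dominated by the number of colour sets, at most
`(2ekd)^d`; the factors exponential or polynomial in `d` are absorbed by a second `d^d`. -/

/-! ### Counting probability: union bounds, independence, Chernoff, sampling of seeds -/

section FiniteProbability

open scoped Classical in
/-- The probability of an event under the uniform distribution on a finite type. -/
noncomputable def uniformProb {Ω : Type*} [Fintype Ω] (p : Ω → Prop) : ℝ :=
  (∑ ω, if p ω then (1 : ℝ) else 0) / Fintype.card Ω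

variable {Ω : Type*} [Fintype Ω]

theorem uniformProb_eq_card_div (p : Ω → Prop) [DecidablePred p] :
    uniformProb p = ((Finset.univ.filter p).card : ℝ) / Fintype.card Ω := by
  classical
  unfold uniformProb
  rw [← Finset.sum_boole]
  congr!

theorem uniformProb_nonneg (p : Ω → Prop) : 0 ≤ uniformProb p := by
  classical
  rw [uniformProb_eq_card_div]; positivity

theorem uniformProb_mono {p q : Ω → Prop} (h : ∀ ω, p ω → q ω) :
    uniformProb p ≤ uniformProb q := by
  classical
  rw [uniformProb_eq_card_div, uniformProb_eq_card_div]
  gcongr with ω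
  exact h ω

theorem uniformProb_or_le (p q : Ω → Prop) :
    uniformProb (fun ω => p ω ∨ q ω) ≤ uniformProb p + uniformProb q := by
  classical
  simp only [uniformProb_eq_card_div]
  rw [← add_div]
  gcongr
  rw [Finset.filter_or]
  exact_mod_cast Finset.card_union_le _ _

theorem uniformProb_exists_finset_le {ι : Type*} (s : Finset ι) (p : ι → Ω → Prop) :
    uniformProb (fun ω => ∃ i ∈ s, p i ω) ≤ ∑ i ∈ s, uniformProb (p i) := by
  classical
  simp only [uniformProb_eq_card_div]
  rw [← Finset.sum_div]
  gcongr
  have : (Finset.univ.filter fun ω => ∃ i ∈ s, p i ω)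
      ⊆ s.biUnion fun i => Finset.univ.filter (p i) := by
    intro ω; simp
  exact_mod_cast (Finset.card_le_card this).trans Finset.card_biUnion_le

theorem uniformProb_exists_finset_le_mul {ι : Type*} (s : Finset ι) (p : ι → Ω → Prop) {ε : ℝ}
    (h : ∀ i ∈ s, uniformProb (p i) ≤ ε) :
    uniformProb (fun ω => ∃ i ∈ s, p i ω) ≤ s.card * ε := by
  refine (uniformProb_exists_finset_le s p).trans ?_
  simpa using Finset.sum_le_card_nsmul s _ ε h

theorem uniformProb_exists_le_mul {ι : Type*} [Fintype ι] (p : ι → Ω → Prop) {ε : ℝ}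
    (h : ∀ i, uniformProb (p i) ≤ ε) :
    uniformProb (fun ω => ∃ i, p i ω) ≤ Fintype.card ι * ε := by
  simpa using uniformProb_exists_finset_le_mul Finset.univ p fun i _ => h i

/-- Markov's inequality. -/
theorem uniformProb_le_average {p : Ω → Prop} {f : Ω → ℝ} (hf : ∀ ω, 0 ≤ f ω)
    (h : ∀ ω, p ω → 1 ≤ f ω) : uniformProb p ≤ (∑ ω, f ω) / Fintype.card Ω := by
  classical
  unfold uniformProb
  gcongr with ω
  split_ifs with hp
  · exact h ω hp
  · exact hf ω

theorem uniformProb_prod_le_of_left {Ω' : Type*} [Fintype Ω'] {p : Ω × Ω' → Prop} {ε : ℝ}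
    (hε : 0 ≤ ε) (h : ∀ ω, uniformProb (fun ω' => p (ω, ω')) ≤ ε) : uniformProb p ≤ ε := by
  classical
  unfold uniformProb at *
  rw [Fintype.sum_prod_type, Fintype.card_prod, Nat.cast_mul, mul_comm, ← div_div,
    Finset.sum_div]
  refine div_le_of_le_mul₀ (by positivity) hε ?_
  calc _ ≤ ∑ _ω : Ω, ε := Finset.sum_le_sum fun ω _ => h ω
    _ = _ := by simp [mul_comm]

theorem uniformProb_prod_le_of_right {Ω' : Type*} [Fintype Ω'] {p : Ω × Ω' → Prop} {ε : ℝ}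
    (hε : 0 ≤ ε) (h : ∀ ω', uniformProb (fun ω => p (ω, ω')) ≤ ε) : uniformProb p ≤ ε := by
  classical
  unfold uniformProb at *
  rw [Fintype.sum_prod_type_right, Fintype.card_prod, Nat.cast_mul, ← div_div,
    Finset.sum_div]
  refine div_le_of_le_mul₀ (by positivity) hε ?_
  calc _ ≤ ∑ _ω : Ω', ε := Finset.sum_le_sum fun ω _ => h ω
    _ = _ := by simp [mul_comm]

/-- Independence of the coordinates of a uniformly random function: expanding a product of sums.
Coordinates outside `B` contribute the factor 1. -/
theorem average_pi_prod {X Y : Type*} [Fintype X] [DecidableEq X] [Fintype Y] [Nonempty Y]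
    (B : Finset X) (g : X → Y → ℝ) :
    (∑ ρ : X → Y, ∏ x ∈ B, g x (ρ x)) / Fintype.card (X → Y)
      = ∏ x ∈ B, (∑ y, g x y) / Fintype.card Y := by
  have hY : (Fintype.card Y : ℝ) ≠ 0 := by simp
  have h := Finset.prod_univ_sum (fun _ : X => (Finset.univ : Finset Y))
    (fun x y => if x ∈ B then g x y else 1)
  rw [Fintype.piFinset_univ] at h
  have h1 : ∀ ρ : X → Y, ∏ x, (if x ∈ B then g x (ρ x) else 1) = ∏ x ∈ B, g x (ρ x) := by
    intro ρ
    rw [Finset.prod_ite_mem, Finset.univ_inter]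
  simp only [h1] at h
  rw [← h, Fintype.card_fun, Nat.cast_pow, ← Finset.card_univ (α := X), ← Finset.prod_const,
    ← Finset.prod_div_distrib, ← Finset.univ_inter B, ← Finset.prod_ite_mem, Finset.univ_inter]
  refine Finset.prod_congr rfl fun x _ => ?_
  by_cases hx : x ∈ B
  · simp [hx]
  · simp [hx, hY]

theorem uniformProb_forall_mem_le {X Y : Type*} [Fintype X] [DecidableEq X] [Fintype Y]
    [Nonempty Y] (B : Finset X) (p : X → Y → Prop) {ε : ℝ}
    (h : ∀ x ∈ B, uniformProb (p x) ≤ ε) :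
    uniformProb (fun ρ : X → Y => ∀ x ∈ B, p x (ρ x)) ≤ ε ^ B.card := by
  classical
  refine (uniformProb_le_average
    (f := fun ρ : X → Y => ∏ x ∈ B, if p x (ρ x) then (1 : ℝ) else 0) ?_ ?_).trans ?_
  · intro ρ
    exact Finset.prod_nonneg fun x _ => by split_ifs <;> norm_num
  · intro ρ hρ
    rw [Finset.prod_congr rfl fun x hx => if_pos (hρ x hx)]
    simp
  · rw [average_pi_prod B fun x y => if p x y then (1 : ℝ) else 0, ← Finset.prod_const]
    exact Finset.prod_le_prod (fun x _ => uniformProb_nonneg (p x)) h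

theorem uniformProb_not [Nonempty Ω] (p : Ω → Prop) :
    uniformProb (fun ω => ¬ p ω) = 1 - uniformProb p := by
  classical
  have hΩ : (Fintype.card Ω : ℝ) ≠ 0 := by simp
  have := Finset.card_filter_add_card_filter_not (s := (Finset.univ : Finset Ω)) p
  rw [uniformProb_eq_card_div, uniformProb_eq_card_div, eq_sub_iff_add_eq, ← add_div,
    div_eq_one_iff_eq hΩ, ← Finset.card_univ, ← this]
  push_cast; ring

/-- A Chernoff bound for the number of successes in independent trials. -/
theorem uniformProb_card_filter_gt_le {X Y : Type*} [Fintype X] [DecidableEq X] [Fintype Y]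
    [Nonempty Y] (B : Finset X) (p : X → Y → Prop) [∀ x, DecidablePred (p x)] {ε r : ℝ}
    (h : ∀ x ∈ B, uniformProb (p x) ≤ ε) :
    uniformProb (fun ρ : X → Y => r ≤ ((B.filter fun x => p x (ρ x)).card : ℝ))
      ≤ Real.exp (2 * ε * B.card - r) := by
  have hY : (Fintype.card Y : ℝ) ≠ 0 := by simp
  have hexp : ∀ ρ : X → Y, ∏ x ∈ B, (if p x (ρ x) then Real.exp 1 else 1)
      = Real.exp ((B.filter fun x => p x (ρ x)).card) := by
    intro ρ
    rw [Finset.prod_ite, Finset.prod_const, Finset.prod_const_one, mul_one, ← Real.exp_nat_mul,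
      mul_one]
  have hM := uniformProb_le_average
    (p := fun ρ : X → Y => r ≤ ((B.filter fun x => p x (ρ x)).card : ℝ))
    (f := fun ρ => (∏ x ∈ B, (if p x (ρ x) then Real.exp 1 else 1)) * Real.exp (-r))
    (fun ρ => by rw [hexp]; positivity)
    (fun ρ hρ => by
      rw [hexp, ← Real.exp_add]
      exact Real.one_le_exp (by linarith))
  refine hM.trans ?_
  rw [← Finset.sum_mul, mul_div_right_comm, average_pi_prod B fun x y =>
    if p x y then Real.exp 1 else 1, sub_eq_add_neg, Real.exp_add]
  gcongr
  rw [mul_comm, Real.exp_nat_mul, ← Finset.prod_const]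
  refine Finset.prod_le_prod (fun x _ => by
    refine div_nonneg (Finset.sum_nonneg fun y _ => ?_) (by positivity)
    split_ifs <;> positivity) fun x hx => ?_
  have : ∀ y, (if p x y then Real.exp 1 else 1)
      = 1 + (Real.exp 1 - 1) * (if p x y then (1 : ℝ) else 0) := by
    intro y; split_ifs <;> ring
  have hx' := h x hx
  rw [uniformProb_eq_card_div, ← Finset.sum_boole] at hx'
  have h0 := (uniformProb_nonneg (p x)).trans (h x hx)
  simp only [this]
  rw [Finset.sum_add_distrib, ← Finset.mul_sum, add_div, mul_div_assoc]
  simp only [Finset.sum_const, Finset.card_univ, nsmul_eq_mul, mul_one, div_self hY]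
  -- The factor 2 in the exponent of the bound comes from `e - 1 ≤ 2`.
  have he : Real.exp 1 - 1 ≤ 2 := by linarith [Real.exp_one_lt_d9]
  have he' : 0 ≤ Real.exp 1 - 1 := by linarith [Real.add_one_le_exp 1]
  calc _ ≤ 1 + 2 * ε := by gcongr
    _ ≤ _ := by linarith [Real.add_one_le_exp (2 * ε)]

/-- A small sample of the random choices serves all inputs from a finite set. -/
theorem exists_sample_of_uniformProb_le [Nonempty Ω] {ι : Type*} (I : Finset ι)
    (bad : ι → Ω → Prop) [∀ i, DecidablePred (bad i)] {ε : ℝ}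
    (h : ∀ i ∈ I, uniformProb (bad i) ≤ ε) (L : ℕ) (hL : (I.card : ℝ) < Real.exp (2 * ε * L)) :
    ∃ f : Fin L → Ω, ∀ i ∈ I,
      ((Finset.univ.filter fun l => bad i (f l)).card : ℝ) ≤ 4 * ε * L := by
  by_contra! hcon
  -- The threshold `4εL` makes each input fail with probability at most `exp(-2εL)`, which `hL`
  -- makes small enough for the union bound.
  have h1 : uniformProb (fun f : Fin L → Ω => ∃ i ∈ I,
      4 * ε * L ≤ ((Finset.univ.filter fun l => bad i (f l)).card : ℝ))
        ≤ I.card * Real.exp (2 * ε * L - 4 * ε * L) := by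
    refine uniformProb_exists_finset_le_mul I _ fun i hi => ?_
    simpa using uniformProb_card_filter_gt_le (Finset.univ : Finset (Fin L)) (fun _ => bad i)
      (r := 4 * ε * L) fun _ _ => h i hi
  have h2 : (1 : ℝ) ≤ uniformProb (fun f : Fin L → Ω => ∃ i ∈ I,
      4 * ε * L ≤ ((Finset.univ.filter fun l => bad i (f l)).card : ℝ)) := by
    have := uniformProb_mono (Ω := Fin L → Ω) (p := fun _ => True) (q := fun f => ∃ i ∈ I,
      4 * ε * L ≤ ((Finset.univ.filter fun l => bad i (f l)).card : ℝ)) fun f _ => by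
        obtain ⟨i, hi, hlt⟩ := hcon f
        exact ⟨i, hi, hlt.le⟩
    refine le_trans (le_of_eq ?_) this
    rw [uniformProb_eq_card_div, Finset.filter_true, Finset.card_univ, div_self]
    simp
  have h3 : (I.card : ℝ) * Real.exp (2 * ε * L - 4 * ε * L) < 1 := by
    have : 2 * ε * L - 4 * ε * L = -(2 * ε * L) := by ring
    rw [this, Real.exp_neg, ← div_eq_mul_inv, div_lt_one (Real.exp_pos _)]
    exact hL
  linarith

end FiniteProbability

/-! ### Both objectives at once, and exchanging sets in optimal solutions -/

section Values

/-- The number of elements `x` such that the number of sets of the collection containing `x`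
satisfies `φ`. -/
def countingValue {n : ℕ} (φ : ℕ → Prop) [DecidablePred φ] (C : Multiset (Finset (Fin n))) : ℕ :=
  (Finset.univ.filter fun x : Fin n => φ (C.countP fun S => x ∈ S)).card

/-- Being covered once is rewarded, and being covered more often is never better. -/
structure IsCoverageCriterion (φ : ℕ → Prop) : Prop where
  not_zero : ¬ φ 0
  one : φ 1
  of_succ : ∀ c, 1 ≤ c → φ (c + 1) → φ c

theorem IsCoverageCriterion.anti {φ : ℕ → Prop} (hφ : IsCoverageCriterion φ) {a b : ℕ} (ha : 1 ≤ a) (hab : a ≤ b)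
    (hb : φ b) : φ a := by
  induction b, hab using Nat.le_induction with
  | base => exact hb
  | succ c hc ih => exact ih (hφ.of_succ c (ha.trans hc) hb)

variable {n : ℕ} {φ : ℕ → Prop} [DecidablePred φ]

theorem countingValue_le_dedup (hφ : IsCoverageCriterion φ) (C : Multiset (Finset (Fin n))) :
    countingValue φ C ≤ countingValue φ C.dedup := by
  refine Finset.card_le_card fun x => ?_
  simp only [Finset.mem_filter, Finset.mem_univ, true_and]
  intro hx
  have h1 : 1 ≤ C.countP fun S => x ∈ S := by
    by_contra h
    rw [Nat.lt_one_iff.mp (not_le.mp h)] at hx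
    exact hφ.not_zero hx
  refine hφ.anti ?_ (Multiset.countP_le_of_le _ C.dedup_le) hx
  obtain ⟨S, hS, hxS⟩ := Multiset.countP_pos.mp h1
  exact Multiset.countP_pos.mpr ⟨S, Multiset.mem_dedup.mpr hS, hxS⟩

/-- Split the universe by the union `U` of `D`. Inside `U` the exchange cannot raise a count and
leaves it at least 1, so no element is lost. Outside `U` each element of the exchanged set counts
once, and `S'` has at least as many such elements as `S`, because the sizes agree and `S' ∩ U ⊆ S ∩
U`. -/
theorem countingValue_le_exchange (hφ : IsCoverageCriterion φ) (D : Multiset (Finset (Fin n)))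
    {S S' : Finset (Fin n)} (hcard : S'.card = S.card) (hsub : ∀ x ∈ S', ∀ R ∈ D, x ∈ R → x ∈ S) :
    countingValue φ (S ::ₘ D) ≤ countingValue φ (S' ::ₘ D) := by
  classical
  set U : Finset (Fin n) := Finset.univ.filter fun x => 1 ≤ D.countP fun R => x ∈ R with hU
  have hmemU : ∀ x, x ∈ U ↔ 1 ≤ D.countP fun R => x ∈ R := by simp [hU]
  have hsubU : ∀ x ∈ S', x ∈ U → x ∈ S := by
    intro x hx hxU
    obtain ⟨R, hR, hxR⟩ := Multiset.countP_pos.mp ((hmemU x).mp hxU)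
    exact hsub x hx R hR hxR
  have hsplit : ∀ R : Finset (Fin n), countingValue φ (R ::ₘ D)
      = (U.filter fun x => φ ((R ::ₘ D).countP fun Q => x ∈ Q)).card + (R \ U).card := by
    intro R
    unfold countingValue
    rw [← Finset.card_filter_add_card_filter_not (fun x => x ∈ U), Finset.filter_filter,
      Finset.filter_filter]
    congr 2
    · ext x; simp [and_comm]
    · ext x
      simp only [Finset.mem_filter, Finset.mem_univ, true_and, Finset.mem_sdiff, hmemU x, not_le,
        Nat.lt_one_iff, Multiset.countP_cons]
      constructor
      · rintro ⟨h, h0⟩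
        refine ⟨?_, h0⟩
        by_contra hx
        rw [h0, if_neg hx] at h
        exact hφ.not_zero h
      · rintro ⟨hx, h0⟩
        rw [h0, if_pos hx]
        exact ⟨hφ.one, rfl⟩
  rw [hsplit, hsplit]
  refine Nat.add_le_add ?_ ?_
  · refine Finset.card_le_card fun x => ?_
    simp only [Finset.mem_filter, Multiset.countP_cons]
    rintro ⟨hxU, h⟩
    have h1 := (hmemU x).mp hxU
    refine ⟨hxU, hφ.anti (by omega) ?_ h⟩
    by_cases hx : x ∈ S'
    · simp [hx, hsubU x hx hxU]
    · simp [hx]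
  · have h1 := Finset.card_sdiff_add_card_inter S U
    have h2 := Finset.card_sdiff_add_card_inter S' U
    have h3 : (S' ∩ U).card ≤ (S ∩ U).card := by
      refine Finset.card_le_card fun x => ?_
      simp only [Finset.mem_inter]
      exact fun ⟨hx, hxU⟩ => ⟨hsubU x hx hxU, hxU⟩
    omega

theorem isCoverageCriterion_one_le : IsCoverageCriterion (fun c => 1 ≤ c) :=
  ⟨by norm_num, le_rfl, fun _ h _ => h⟩

theorem isCoverageCriterion_eq_one : IsCoverageCriterion (fun c => c = 1) :=
  ⟨by norm_num, rfl, fun c h h' => by omega⟩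

theorem coverage_eq_countingValue :
    (coverage : Multiset (Finset (Fin n)) → ℕ) = countingValue (fun c => 1 ≤ c) := rfl

theorem uniqueCoverage_eq_countingValue :
    (uniqueCoverage : Multiset (Finset (Fin n)) → ℕ) = countingValue (fun c => c = 1) := rfl

/-- There is an optimal solution without repeated sets. -/
theorem exists_finset_isOptimalSolution (hφ : IsCoverageCriterion φ) (k : ℕ)
    (M : Multiset (Finset (Fin n))) :
    ∃ C : Finset (Finset (Fin n)), IsOptimalSolution (countingValue φ) k M C.val := by
  classical
  obtain ⟨C, hC, hmax⟩ := Finset.exists_max_image (M.toFinset.powerset.filter fun C => C.card ≤ k)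
    (fun C => countingValue φ C.val) ⟨∅, by simp⟩
  simp only [Finset.mem_filter, Finset.mem_powerset] at hC hmax
  refine ⟨C, Multiset.le_iff_subset C.nodup |>.mpr fun S hS =>
    Multiset.mem_toFinset.mp (hC.1 hS), hC.2, fun C' hle hk => ?_⟩
  refine (countingValue_le_dedup hφ C').trans (hmax C'.toFinset ⟨?_, ?_⟩)
  · exact Multiset.toFinset_subset.mpr (Multiset.subset_of_le hle)
  · exact (Multiset.toFinset_card_le C').trans hk

/-- Among the optimal solutions without repeated sets, there is one in which no set can be exchanged
for a set of smaller rank that has the same size and meets the union of the solution only inside the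
set that it replaces. -/
theorem exists_finset_isOptimalSolution_rank_minimal (hφ : IsCoverageCriterion φ) (k : ℕ)
    (M : Multiset (Finset (Fin n))) (rank : Finset (Fin n) → ℕ) :
    ∃ C : Finset (Finset (Fin n)), IsOptimalSolution (countingValue φ) k M C.val ∧
      ∀ S ∈ C, ∀ S' ∈ M, S'.card = S.card → (∀ x ∈ S', x ∈ C.biUnion id → x ∈ S) →
        rank S ≤ rank S' := by
  classical
  obtain ⟨C₀, hC₀⟩ := exists_finset_isOptimalSolution hφ k M
  obtain ⟨C, hC, hmin⟩ := Finset.exists_min_image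
    (Finset.univ.filter fun C : Finset (Finset (Fin n)) =>
      IsOptimalSolution (countingValue φ) k M C.val)
    (fun C => ∑ S ∈ C, rank S) ⟨C₀, by simpa using hC₀⟩
  simp only [Finset.mem_filter, Finset.mem_univ, true_and] at hC hmin
  refine ⟨C, hC, fun S hS S' hS' hcard hsub => ?_⟩
  by_cases hSS : S' = S
  · rw [hSS]
  -- A member of `C` lies in the union of `C`, hence would be contained in `S`, and equal sizes
  -- would give `S' = S`.
  have hnot : S' ∉ C := by
    intro hmem
    refine hSS (Finset.eq_of_subset_of_card_le (fun x hx => hsub x hx ?_) hcard.ge)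
    exact Finset.mem_biUnion.mpr ⟨S', hmem, hx⟩
  have hnot' : S' ∉ C.erase S := fun h => hnot (Finset.mem_of_mem_erase h)
  have hval : C.val = S ::ₘ (C.erase S).val := by
    rw [← Finset.insert_val_of_notMem (Finset.notMem_erase S C), Finset.insert_erase hS]
  have hle := countingValue_le_exchange hφ (C.erase S).val hcard fun x hx R hR hxR =>
    hsub x hx (Finset.mem_biUnion.mpr ⟨R, Finset.mem_of_mem_erase hR, hxR⟩)
  rw [← hval, ← Finset.insert_val_of_notMem hnot'] at hle
  have hopt : IsOptimalSolution (countingValue φ) k M (insert S' (C.erase S)).val := by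
    refine ⟨?_, ?_, fun C' h1 h2 => (hC.2.2 C' h1 h2).trans hle⟩
    · refine Multiset.le_iff_subset (Finset.nodup _) |>.mpr fun R hR => ?_
      rcases Finset.mem_insert.mp hR with rfl | hR
      · exact hS'
      · exact Multiset.subset_of_le hC.1 (Finset.mem_of_mem_erase hR)
    · have := hC.2.1
      change (insert S' (C.erase S)).card ≤ k
      change C.card ≤ k at this
      rw [Finset.card_insert_of_notMem hnot', Finset.card_erase_add_one hS]
      exact this
  have := hmin _ hopt
  rw [Finset.sum_insert hnot', ← Finset.add_sum_erase C _ hS] at this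
  omega

end Values

/-! ### From additive sketches to streaming algorithms -/

section LinearSketch

variable {n : ℕ}

/-- The effect of an update on a sketch that is additive over the sets of the collection. -/
def sketchUpdate {G : Type*} [AddCommGroup G] (sketch : Finset (Fin n) → G) (g : G) :
    SetUpdate n → G
  | .insert S => g + sketch S
  | .delete S => g - sketch S

/-- Validity is essential: erasing an absent set would change nothing, while the sketch would still
subtract. -/
theorem IsValidStreamFrom.foldl_sketchUpdate {G : Type*} [AddCommGroup G]
    (sketch : Finset (Fin n) → G) {m d : ℕ} (us : List (SetUpdate n)) :
    ∀ M : Multiset (Finset (Fin n)), IsValidStreamFrom m d M us →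
      us.foldl (sketchUpdate sketch) (M.map sketch).sum
        = ((us.foldl SetUpdate.apply M).map sketch).sum := by
  induction us with
  | nil => intro M _; rfl
  | cons u us ih =>
    intro M h
    cases u with
    | insert S =>
      have := ih _ h.2.2
      rw [Multiset.map_cons, Multiset.sum_cons, add_comm] at this
      simpa [sketchUpdate, SetUpdate.apply] using this
    | delete S =>
      have := ih _ h.2
      have hM : (M.map sketch).sum - sketch S = ((M.erase S).map sketch).sum := by
        conv_lhs => rw [← Multiset.cons_erase h.1]
        simp
      simpa [sketchUpdate, SetUpdate.apply, hM] using this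

theorem IsValidStreamFrom.card_le_and_card_le {m d : ℕ} (us : List (SetUpdate n)) :
    ∀ M : Multiset (Finset (Fin n)), IsValidStreamFrom m d M us → M.card ≤ m →
      (∀ S ∈ M, S.card ≤ d) → (us.foldl SetUpdate.apply M).card ≤ m ∧
        ∀ S ∈ us.foldl SetUpdate.apply M, S.card ≤ d := by
  induction us with
  | nil => exact fun M _ h1 h2 => ⟨h1, h2⟩
  | cons u us ih =>
    intro M h h1 h2
    cases u with
    | insert S =>
      refine ih _ h.2.2 h.2.1 fun R hR => ?_
      rcases Multiset.mem_cons.mp hR with rfl | hR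
      · exact h.1
      · exact h2 R hR
    | delete S =>
      exact ih _ h.2 ((Multiset.card_le_card (Multiset.erase_le S M)).trans h1)
        fun R hR => h2 R (Multiset.mem_of_mem_erase hR)

/-- The streaming algorithm that keeps the index of a random choice and an additive sketch. -/
noncomputable def sketchAlgorithm {L s : ℕ} [NeZero L] {G : Type*} [AddCommGroup G]
    (enc : Fin L × G ↪ (Fin s → Bool)) (sketch : Fin L → Finset (Fin n) → G)
    (decode : Fin L → G → Multiset (Finset (Fin n))) : StreamingAlgorithm n s where
  init := (PMF.uniformOfFintype (Fin L)).map fun i => enc (i, 0)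
  -- `Function.invFun enc` recovers the state since `enc` is injective; its arbitrary values on
  -- other memory contents are never reached.
  step σ u := PMF.pure <| enc
    ((Function.invFun enc σ).1, sketchUpdate (sketch (Function.invFun enc σ).1)
      (Function.invFun enc σ).2 u)
  output σ := PMF.pure <| decode (Function.invFun enc σ).1 (Function.invFun enc σ).2

theorem sketchAlgorithm_runFrom {L s : ℕ} [NeZero L] {G : Type*} [AddCommGroup G]
    (enc : Fin L × G ↪ (Fin s → Bool)) (sketch : Fin L → Finset (Fin n) → G)
    (decode : Fin L → G → Multiset (Finset (Fin n))) (i : Fin L) (us : List (SetUpdate n)) :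
    ∀ g : G, (sketchAlgorithm enc sketch decode).runFrom (enc (i, g)) us
      = PMF.pure (enc (i, us.foldl (sketchUpdate (sketch i)) g)) := by
  induction us with
  | nil => exact fun g => rfl
  | cons u us ih =>
    intro g
    simp only [StreamingAlgorithm.runFrom, sketchAlgorithm,
      Function.leftInverse_invFun enc.injective (i, g), PMF.pure_bind, List.foldl_cons]
    exact ih _

theorem sketchAlgorithm_result {L s : ℕ} [NeZero L] {G : Type*} [AddCommGroup G]
    (enc : Fin L × G ↪ (Fin s → Bool)) (sketch : Fin L → Finset (Fin n) → G)
    (decode : Fin L → G → Multiset (Finset (Fin n))) (us : List (SetUpdate n)) :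
    (sketchAlgorithm enc sketch decode).result us = (PMF.uniformOfFintype (Fin L)).map
      fun i => decode i (us.foldl (sketchUpdate (sketch i)) 0) := by
  unfold StreamingAlgorithm.result
  have : (sketchAlgorithm enc sketch decode).init
      = (PMF.uniformOfFintype (Fin L)).bind fun i => PMF.pure (enc (i, 0)) := rfl
  rw [this, PMF.bind_bind, PMF.bind_bind]
  simp only [PMF.pure_bind, sketchAlgorithm_runFrom]
  simp only [sketchAlgorithm, Function.leftInverse_invFun enc.injective (_, _)]
  rfl

/-- Bounds the number of possible final collections, the inputs that the list of seeds must serve.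
-/
theorem card_Iic_le_pow (m d : ℕ) :
    (Finset.Iic (m • (Finset.univ.filter fun S : Finset (Fin n) => S.card ≤ d).val)).card
      ≤ (m + 1) ^ (Finset.univ.filter fun S : Finset (Fin n) => S.card ≤ d).card := by
  classical
  rw [Multiset.card_Iic]
  refine (Finset.prod_le_pow_card _ _ (m + 1) fun S _ => ?_).trans
    (Nat.pow_le_pow_right (by omega) (Finset.card_le_card ?_))
  · rw [Multiset.count_nsmul]
    have := Multiset.nodup_iff_count_le_one.mp
      (Finset.univ.filter fun S : Finset (Fin n) => S.card ≤ d).nodup S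
    nlinarith
  · intro S hS
    rw [Multiset.mem_toFinset] at hS
    exact Multiset.mem_of_mem_nsmul hS

/-- A randomized additive sketch that fails with small probability on every collection yields a
streaming algorithm; the random choices are replaced by the index of one of `L` samples. -/
theorem exists_streamingAlgorithm_of_sketch {m d k : ℕ}
    (value : Multiset (Finset (Fin n)) → ℕ) {Ω : Type*} [Fintype Ω] [Nonempty Ω] {G : Type*}
    [AddCommGroup G] [Fintype G] (sketch : Ω → Finset (Fin n) → G)
    (decode : Ω → G → Multiset (Finset (Fin n))) {ε : ℝ}
    (h : ∀ M : Multiset (Finset (Fin n)), M.card ≤ m → (∀ S ∈ M, S.card ≤ d) →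
      uniformProb (fun ω =>
        ¬ IsOptimalSolution value k M (decode ω (M.map (sketch ω)).sum)) ≤ ε)
    (L : ℕ) (hL : 0 < L)
    (hcount : ((m + 1 : ℝ) ^ (Finset.univ.filter fun S : Finset (Fin n) => S.card ≤ d).card)
      < Real.exp (2 * ε * L))
    {s : ℕ} (hs : L * Fintype.card G ≤ 2 ^ s) :
    ∃ A : StreamingAlgorithm n s, A.SolvesExactly value m d k (ENNReal.ofReal (4 * ε)) := by
  classical
  have hsub : ∀ M : Multiset (Finset (Fin n)), M.card ≤ m → (∀ S ∈ M, S.card ≤ d) →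
      M ≤ m • (Finset.univ.filter fun S : Finset (Fin n) => S.card ≤ d).val := by
    intro M h1 h2
    rw [Multiset.le_iff_count]
    intro S
    by_cases hS : S ∈ M
    · rw [Multiset.count_nsmul, Multiset.count_eq_one_of_mem (Finset.nodup _)
        (by simpa using h2 S hS), mul_one]
      exact (Multiset.count_le_card S M).trans h1
    · rw [Multiset.count_eq_zero_of_notMem hS]
      exact Nat.zero_le _
  obtain ⟨f, hf⟩ := exists_sample_of_uniformProb_le
    ((Finset.Iic (m • (Finset.univ.filter fun S : Finset (Fin n) => S.card ≤ d).val)).filter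
      fun M => M.card ≤ m ∧ ∀ S ∈ M, S.card ≤ d)
    (fun M ω => ¬ IsOptimalSolution value k M (decode ω (M.map (sketch ω)).sum))
    (fun M hM => h M (Finset.mem_filter.mp hM).2.1 (Finset.mem_filter.mp hM).2.2) L
    (lt_of_le_of_lt (by
      exact_mod_cast (Finset.card_filter_le _ _).trans (card_Iic_le_pow m d)) hcount)
  have : NeZero L := ⟨hL.ne'⟩
  obtain ⟨enc⟩ : Nonempty (Fin L × G ↪ (Fin s → Bool)) := by
    refine Function.Embedding.nonempty_of_card_le ?_
    simpa using hs
  refine ⟨sketchAlgorithm enc (fun i => sketch (f i)) (fun i => decode (f i)), fun us hus => ?_⟩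
  have hfold : ∀ i, us.foldl (sketchUpdate (sketch (f i))) 0
      = ((finalCollection us).map (sketch (f i))).sum := fun i => by
    simpa [finalCollection] using IsValidStreamFrom.foldl_sketchUpdate (sketch (f i)) us 0 hus
  obtain ⟨h1, h2⟩ := IsValidStreamFrom.card_le_and_card_le us 0 hus (by simp) (by simp)
  have hmem := hf (finalCollection us) (by
    rw [Finset.mem_filter, Finset.mem_Iic]
    exact ⟨hsub _ h1 h2, h1, h2⟩)
  rw [sketchAlgorithm_result]
  simp only [hfold]
  rw [PMF.toOuterMeasure_map_apply, PMF.toOuterMeasure_uniformOfFintype_apply]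
  have hcard : Fintype.card ((fun i => decode (f i)
      ((finalCollection us).map (sketch (f i))).sum) ⁻¹'
        {C | ¬ IsOptimalSolution value k (finalCollection us) C})
      = (Finset.univ.filter fun l => ¬ IsOptimalSolution value k (finalCollection us)
          (decode (f l) ((finalCollection us).map (sketch (f l))).sum)).card :=
    Fintype.card_of_subtype _ (by simp)
  rw [hcard, Fintype.card_fin]
  have hL' : (0 : ℝ) < L := by exact_mod_cast hL
  rw [← ENNReal.ofReal_natCast, ← ENNReal.ofReal_natCast, ← ENNReal.ofReal_div_of_pos hL']
  refine ENNReal.ofReal_le_ofReal ?_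
  rw [div_le_iff₀ hL']
  exact hmem

end LinearSketch

/-! ### The sketch, its decoding, and correctness for a good seed -/

section CoverageSketch

/-- The random choices of the sketch: a priority for each set, `T` colourings of the universe, and
`w` random linear functionals. -/
abbrev SketchSeed (n b T J w q : ℕ) : Type :=
  (Finset (Fin n) → Fin (2 ^ J)) × (Fin T → Fin n → Fin b) × (Fin w → Finset (Fin n) → ZMod q)

/-- A cell is given by a colouring, a size, a set of colours and a level. -/
abbrev SketchCell (b T J d : ℕ) : Type :=
  Fin T × Fin (d + 1) × {P : Finset (Fin b) // P.card ≤ d} × Fin (J + 1)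

/-- A cell contains the sets of its size that have its set of colours and a priority below the bound
of its level. -/
def InCell {n b T J d : ℕ} (ρ : Finset (Fin n) → Fin (2 ^ J)) (h : Fin T → Fin n → Fin b)
    (c : SketchCell b T J d) (S : Finset (Fin n)) : Prop :=
  S.image (h c.1) = c.2.2.1 ∧ S.card = c.2.1 ∧ (ρ S : ℕ) < 2 ^ (J - (c.2.2.2 : ℕ))

instance {n b T J d : ℕ} (ρ : Finset (Fin n) → Fin (2 ^ J)) (h : Fin T → Fin n → Fin b)
    (c : SketchCell b T J d) : DecidablePred (InCell ρ h c) := fun _ => by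
  unfold InCell; infer_instance

variable {n b T J w q d s : ℕ}

/-- The contribution of a set to the sketch: in every cell that contains it, the values of the
linear functionals. -/
def cellSketch (d : ℕ) (ω : SketchSeed n b T J w q) (S : Finset (Fin n)) :
    SketchCell b T J d → Fin w → ZMod q :=
  fun c r => if InCell ω.1 ω.2.1 c S then ω.2.2 r S else 0

/-- The multiplicities of the sets of a collection in a cell. -/
def cellVector (q : ℕ) (ρ : Finset (Fin n) → Fin (2 ^ J)) (h : Fin T → Fin n → Fin b)
    (M : Multiset (Finset (Fin n))) (c : SketchCell b T J d) (S : Finset (Fin n)) : ZMod q :=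
  if InCell ρ h c S then (M.count S : ZMod q) else 0

theorem sum_map_cellSketch (ω : SketchSeed n b T J w q) (M : Multiset (Finset (Fin n)))
    (c : SketchCell b T J d) (r : Fin w) :
    (M.map (cellSketch d ω)).sum c r = ∑ S, ω.2.2 r S * cellVector q ω.1 ω.2.1 M c S := by
  induction M using Multiset.induction_on with
  | empty => simp [cellVector]
  | cons R M ih =>
    have : ∀ S, ω.2.2 r S * cellVector q ω.1 ω.2.1 (R ::ₘ M) c S
        = (if S = R then cellSketch d ω R c r else 0)
          + ω.2.2 r S * cellVector q ω.1 ω.2.1 M c S := by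
      intro S
      unfold cellVector cellSketch
      by_cases hS : S = R
      · subst hS
        rw [if_pos rfl, Multiset.count_cons_self]
        split_ifs
        · push_cast; ring
        · simp
      · rw [Multiset.count_cons_of_ne hS, if_neg hS, zero_add]
    rw [Multiset.map_cons, Multiset.sum_cons, Pi.add_apply, Pi.add_apply, ih]
    simp [this, Finset.sum_add_distrib]

/-- The vector with the given entries at the given positions. -/
def sparseVector (f : Fin s → {S : Finset (Fin n) // S.card ≤ d} × ZMod q) :
    Finset (Fin n) → ZMod q :=
  ∑ i, Pi.single ((f i).1 : Finset (Fin n)) (f i).2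

theorem exists_sparseVector_eq (v : Finset (Fin n) → ZMod q)
    (hd : ∀ S, v S ≠ 0 → S.card ≤ d) (hs : (Finset.univ.filter fun S => v S ≠ 0).card ≤ s) :
    ∃ f : Fin s → {S : Finset (Fin n) // S.card ≤ d} × ZMod q, sparseVector f = v := by
  classical
  set B := Finset.univ.filter fun S => v S ≠ 0 with hB
  have hBd : ∀ S : B, (S : Finset (Fin n)).card ≤ d := fun S =>
    hd S (Finset.mem_filter.mp S.2).2
  let e := B.equivFin
  -- Unused positions are padded with the value 0 at `∅`, which changes nothing.
  let entry : ℕ → {S : Finset (Fin n) // S.card ≤ d} × ZMod q := fun j =>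
    if hj : j < B.card then (⟨(e.symm ⟨j, hj⟩ : B), hBd _⟩, v (e.symm ⟨j, hj⟩ : B))
    else (⟨∅, by simp⟩, 0)
  let term : ℕ → Finset (Fin n) → ZMod q := fun j =>
    Pi.single ((entry j).1 : Finset (Fin n)) (entry j).2
  let single : B → Finset (Fin n) → ZMod q := fun S => Pi.single (S : Finset (Fin n)) (v S)
  have hterm : ∀ i : Fin B.card, term i = single (e.symm i) := fun i => by
    simp [term, entry, single]
  refine ⟨fun i => entry i, ?_⟩
  change ∑ i : Fin s, term i = v
  rw [Fin.sum_univ_eq_sum_range term, ← Finset.sum_subset (Finset.range_mono hs),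
    ← Fin.sum_univ_eq_sum_range, Finset.sum_congr rfl fun i _ => hterm i,
    Equiv.sum_comp e.symm single,
    Finset.sum_coe_sort B (fun S => (Pi.single S (v S) : Finset (Fin n) → ZMod q))]
  · conv_rhs => rw [← Finset.univ_sum_single v]
    refine Finset.sum_subset (Finset.subset_univ _) fun S _ hS => ?_
    have : v S = 0 := by simpa [hB] using hS
    rw [this, Pi.single_zero]
  · intro j _ hj
    have : ¬ j < B.card := by simpa using hj
    simp [term, entry, this]

/-- The sets in the supports of the sparse vectors that agree with the sketch in some cell. -/
noncomputable def sketchKernel (s : ℕ) (ω : SketchSeed n b T J w q)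
    (g : SketchCell b T J d → Fin w → ZMod q) : Finset (Finset (Fin n)) :=
  open scoped Classical in Finset.univ.filter fun S =>
    ∃ (c : SketchCell b T J d) (f : Fin s → {S : Finset (Fin n) // S.card ≤ d} × ZMod q),
      (∀ r, ∑ R, ω.2.2 r R * sparseVector f R = g c r) ∧ sparseVector f S ≠ 0

theorem mem_sketchKernel_iff {ω : SketchSeed n b T J w q}
    {g : SketchCell b T J d → Fin w → ZMod q} {S : Finset (Fin n)} :
    S ∈ sketchKernel s ω g ↔
      ∃ (c : SketchCell b T J d) (f : Fin s → {S : Finset (Fin n) // S.card ≤ d} × ZMod q),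
        (∀ r, ∑ R, ω.2.2 r R * sparseVector f R = g c r) ∧ sparseVector f S ≠ 0 := by
  classical
  simp [sketchKernel]

theorem exists_best_subset (value : Multiset (Finset (Fin n)) → ℕ) (k : ℕ)
    (K : Finset (Finset (Fin n))) :
    ∃ C : Finset (Finset (Fin n)), (C ⊆ K ∧ C.card ≤ k) ∧
      ∀ C' : Finset (Finset (Fin n)), C' ⊆ K → C'.card ≤ k → value C'.val ≤ value C.val := by
  obtain ⟨C, hC, hmax⟩ := Finset.exists_max_image (K.powerset.filter fun C => C.card ≤ k)
    (fun C => value C.val) ⟨∅, by simp⟩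
  simp only [Finset.mem_filter, Finset.mem_powerset] at hC hmax
  exact ⟨C, hC, fun C' h1 h2 => hmax C' ⟨h1, h2⟩⟩

/-- A solution of maximum value among those that use every set of `K` at most once. -/
noncomputable def bestSubset (value : Multiset (Finset (Fin n)) → ℕ) (k : ℕ)
    (K : Finset (Finset (Fin n))) : Multiset (Finset (Fin n)) :=
  (exists_best_subset value k K).choose.val

theorem isOptimalSolution_bestSubset {value : Multiset (Finset (Fin n)) → ℕ} {k : ℕ}
    {M : Multiset (Finset (Fin n))} {K C : Finset (Finset (Fin n))} (hK : ∀ S ∈ K, S ∈ M)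
    (hC : IsOptimalSolution value k M C.val) (hCK : C ⊆ K) :
    IsOptimalSolution value k M (bestSubset value k K) := by
  obtain ⟨⟨h1, h2⟩, h3⟩ := (exists_best_subset value k K).choose_spec
  refine ⟨?_, h2, fun C' h4 h5 => (hC.2.2 C' h4 h5).trans (h3 C hCK hC.2.1)⟩
  exact (Multiset.le_iff_subset (Finset.nodup _)).mpr fun S hS => hK S (h1 hS)

/-- The vectors decoded from the sketch are the right ones. -/
def DecodesCells (d s : ℕ) (M : Multiset (Finset (Fin n))) (ω : SketchSeed n b T J w q) : Prop :=
  ∀ (c : SketchCell b T J d) (f : Fin s → {S : Finset (Fin n) // S.card ≤ d} × ZMod q),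
    (∀ r, ∑ R, ω.2.2 r R * (sparseVector f R - cellVector q ω.1 ω.2.1 M c R) = 0) →
      sparseVector f = cellVector q ω.1 ω.2.1 M c

/-- The sets of the collection that have the same size and the same colours as `S`. -/
def bucket (M : Multiset (Finset (Fin n))) (h : Fin n → Fin b) (S : Finset (Fin n)) :
    Finset (Finset (Fin n)) :=
  M.toFinset.filter fun S' => S'.image h = S.image h ∧ S'.card = S.card

/-- At some level, the number of the given sets that survive is positive and at most `s`. -/
def HasGoodLevel (s : ℕ) (ρ : Finset (Fin n) → Fin (2 ^ J)) (B : Finset (Finset (Fin n))) : Prop :=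
  ∃ j : Fin (J + 1), 1 ≤ (B.filter fun S => (ρ S : ℕ) < 2 ^ (J - (j : ℕ))).card ∧
    (B.filter fun S => (ρ S : ℕ) < 2 ^ (J - (j : ℕ))).card ≤ s

/-- Some colouring gives the elements of `S` colours that do not occur in `U \ S`. -/
def IsSeparated (h : Fin T → Fin n → Fin b) (S U : Finset (Fin n)) : Prop :=
  ∃ t, ∀ x ∈ S, ∀ y ∈ U \ S, h t x ≠ h t y

/-- No false positives, even from overfull cells: a sparse vector that agrees with the sketch of a
cell must be the true vector of that cell. -/
theorem DecodesCells.mem_of_mem_sketchKernel {M : Multiset (Finset (Fin n))}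
    {ω : SketchSeed n b T J w q} (hω : DecodesCells d s M ω) {S : Finset (Fin n)}
    (hS : S ∈ sketchKernel s ω (M.map (cellSketch d ω)).sum) : S ∈ M := by
  obtain ⟨c, f, hf, hne⟩ := mem_sketchKernel_iff.mp hS
  have := hω c f fun r => by
    simp only [mul_sub, Finset.sum_sub_distrib]
    rw [hf r, sum_map_cellSketch, sub_self]
  rw [this] at hne
  by_contra hSM
  refine hne ?_
  unfold cellVector
  rw [Multiset.count_eq_zero_of_notMem hSM]
  simp

/-- A cell with few sets has a sparse vector, so exhaustive search finds it. As multiplicities are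
below `q`, they do not vanish modulo `q`. -/
theorem mem_sketchKernel {M : Multiset (Finset (Fin n))} {ω : SketchSeed n b T J w q}
    (hd : ∀ S ∈ M, S.card ≤ d) (c : SketchCell b T J d)
    (hs : (M.toFinset.filter (InCell ω.1 ω.2.1 c)).card ≤ s) (hq : M.card < q)
    {S : Finset (Fin n)} (hS : S ∈ M) (hSc : InCell ω.1 ω.2.1 c S) :
    S ∈ sketchKernel s ω (M.map (cellSketch d ω)).sum := by
  have hmem : ∀ R, cellVector q ω.1 ω.2.1 M c R ≠ 0 → R ∈ M ∧ InCell ω.1 ω.2.1 c R := by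
    intro R hR
    unfold cellVector at hR
    split_ifs at hR with hc
    · refine ⟨?_, hc⟩
      by_contra hRM
      rw [Multiset.count_eq_zero_of_notMem hRM] at hR
      simp at hR
    · simp at hR
  obtain ⟨f, hf⟩ := exists_sparseVector_eq (s := s) (d := d) (cellVector q ω.1 ω.2.1 M c)
    (fun R hR => hd R (hmem R hR).1)
    ((Finset.card_le_card fun R hR => by
      have := hmem R (Finset.mem_filter.mp hR).2
      simpa using this).trans hs)
  refine mem_sketchKernel_iff.mpr ⟨c, f, fun r => ?_, ?_⟩
  · rw [hf, sum_map_cellSketch]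
  · rw [hf, cellVector, if_pos hSc, Ne, ZMod.natCast_eq_zero_iff]
    exact Nat.not_dvd_of_pos_of_lt (Multiset.count_pos.mpr hS)
      ((Multiset.count_le_card S M).trans_lt hq)

/-- Deterministic core. At a good level of a separating colouring some `S'` of the bucket of `S`
survives. Separation makes it a legal replacement for `S`, so `S` has no larger priority and
survives too, in a cell that can be decoded. -/
theorem isOptimalSolution_of_sketch {φ : ℕ → Prop} [DecidablePred φ] {k : ℕ}
    {M : Multiset (Finset (Fin n))} {ω : SketchSeed n b T J w q}
    (hd : ∀ S ∈ M, S.card ≤ d) (hq : M.card < q) (hdec : DecodesCells d s M ω)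
    (hlev : ∀ S ∈ M.toFinset, ∀ t, HasGoodLevel s ω.1 (bucket M (ω.2.1 t) S))
    {C : Finset (Finset (Fin n))} (hC : IsOptimalSolution (countingValue φ) k M C.val)
    (hmin : ∀ S ∈ C, ∀ S' ∈ M, S'.card = S.card → (∀ x ∈ S', x ∈ C.biUnion id → x ∈ S) →
        (ω.1 S : ℕ) ≤ ω.1 S')
    (hsep : ∀ S ∈ C, IsSeparated ω.2.1 S (C.biUnion id)) :
    IsOptimalSolution (countingValue φ) k M
      (bestSubset (countingValue φ) k (sketchKernel s ω (M.map (cellSketch d ω)).sum)) := by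
  refine isOptimalSolution_bestSubset (fun S hS => hdec.mem_of_mem_sketchKernel hS) hC
    fun S hS => ?_
  have hSM : S ∈ M := Multiset.subset_of_le hC.1 hS
  obtain ⟨t, ht⟩ := hsep S hS
  obtain ⟨j, hj1, hj2⟩ := hlev S (Multiset.mem_toFinset.mpr hSM) t
  obtain ⟨S', hS'⟩ := Finset.card_pos.mp hj1
  simp only [bucket, Finset.mem_filter, Multiset.mem_toFinset] at hS'
  obtain ⟨⟨hS'M, himg, hcard⟩, hρ⟩ := hS'
  have hle : (ω.1 S : ℕ) ≤ ω.1 S' := by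
    refine hmin S hS S' hS'M hcard fun x hx hxC => ?_
    by_contra hxS
    have : ω.2.1 t x ∈ S.image (ω.2.1 t) := himg ▸ Finset.mem_image_of_mem _ hx
    obtain ⟨y, hy, hyx⟩ := Finset.mem_image.mp this
    exact ht y hy x (Finset.mem_sdiff.mpr ⟨hxC, hxS⟩) hyx
  let c : SketchCell b T J d := (t, ⟨S.card, Nat.lt_succ_of_le (hd S hSM)⟩,
    ⟨S.image (ω.2.1 t), Finset.card_image_le.trans (hd S hSM)⟩, j)
  refine mem_sketchKernel hd c ?_ hq hSM ⟨rfl, rfl, hle.trans_lt hρ⟩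
  refine le_trans (Finset.card_le_card fun R hR => ?_) hj2
  simp only [Finset.mem_filter, Multiset.mem_toFinset, bucket] at hR ⊢
  exact ⟨⟨hR.1, hR.2.1, hR.2.2.1⟩, hR.2.2.2⟩

end CoverageSketch

/-! ### Failure probability of a random seed -/

section SketchProbability

/-- Adding 1 to the coefficient at some `x₀` with `z x₀ ≠ 0` maps solutions injectively to
non-solutions. Hence `q` need not be prime. -/
theorem uniformProb_sum_mul_eq_zero_le {X : Type*} [Fintype X] [DecidableEq X] {q : ℕ} [NeZero q]
    {z : X → ZMod q} (hz : z ≠ 0) :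
    uniformProb (fun a : X → ZMod q => ∑ x, a x * z x = 0) ≤ 1 / 2 := by
  obtain ⟨x₀, hx₀⟩ := Function.ne_iff.mp hz
  rw [uniformProb_eq_card_div, div_le_iff₀ (by positivity)]
  have h1 := Finset.card_filter_add_card_filter_not (s := (Finset.univ : Finset (X → ZMod q)))
    (fun a => ∑ x, a x * z x = 0)
  have h2 : (Finset.univ.filter fun a : X → ZMod q => ∑ x, a x * z x = 0).card
      ≤ (Finset.univ.filter fun a : X → ZMod q => ¬ ∑ x, a x * z x = 0).card := by
    refine Finset.card_le_card_of_injOn (fun a => a + Pi.single x₀ 1) (fun a ha => ?_)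
      (fun a _ a' _ h => add_right_cancel h)
    have ha' : ∑ x, a x * z x = 0 := by simpa using ha
    have : ∑ x, (a + Pi.single x₀ 1 : X → ZMod q) x * z x = z x₀ := by
      simp [add_mul, Finset.sum_add_distrib, ha', Pi.single_apply]
    rw [Finset.coe_filter, Set.mem_ofPred_eq, this]
    exact ⟨Finset.mem_univ _, hx₀⟩
  rw [Finset.card_univ] at h1
  have h3 : (2 : ℝ) * (Finset.univ.filter fun a : X → ZMod q => ∑ x, a x * z x = 0).card
      ≤ Fintype.card (X → ZMod q) := by
    exact_mod_cast (by omega : 2 * _ ≤ Fintype.card (X → ZMod q))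
  linarith

theorem uniformProb_forall_sum_mul_eq_zero_le {X : Type*} [Fintype X] [DecidableEq X] {q : ℕ}
    [NeZero q] (w : ℕ) {z : X → ZMod q} (hz : z ≠ 0) :
    uniformProb (fun A : Fin w → X → ZMod q => ∀ r, ∑ x, A r x * z x = 0) ≤ (1 / 2) ^ w := by
  simpa using uniformProb_forall_mem_le (Finset.univ : Finset (Fin w))
    (fun _ (a : X → ZMod q) => ∑ x, a x * z x = 0) fun _ _ => uniformProb_sum_mul_eq_zero_le hz

/-- Recolouring `x` arbitrarily is injective on pairs of a colliding `h` and a new colour, because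
the old `h x` can be read off at `y`. -/
theorem uniformProb_apply_eq_le {X : Type*} [Fintype X] [DecidableEq X] {b : ℕ} [NeZero b]
    {x y : X} (hxy : x ≠ y) : uniformProb (fun h : X → Fin b => h x = h y) ≤ 1 / b := by
  have hb : (0 : ℝ) < b := by exact_mod_cast NeZero.pos b
  rw [uniformProb_eq_card_div, div_le_div_iff₀ (by positivity) hb, one_mul]
  have : ((Finset.univ.filter fun h : X → Fin b => h x = h y) ×ˢ
      (Finset.univ : Finset (Fin b))).card ≤ (Finset.univ : Finset (X → Fin b)).card := by
    refine Finset.card_le_card_of_injOn (fun p => Function.update p.1 x p.2)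
      (fun _ _ => Finset.mem_univ _) ?_
    rintro ⟨h, c⟩ hp ⟨h', c'⟩ hp' heq
    simp only [Finset.coe_product, Set.mem_prod, Finset.coe_filter, Set.mem_ofPred_eq,
      Finset.mem_univ, true_and] at hp hp'
    have hval : ∀ z, z ≠ x → h z = h' z := fun z hz => by
      simpa [hz] using congrFun heq z
    have hc : c = c' := by simpa using congrFun heq x
    refine Prod.ext (funext fun z => ?_) hc
    by_cases hz : z = x
    · rw [hz]
      exact hp.1.trans ((hval y hxy.symm).trans hp'.1.symm)
    · exact hval z hz
  rw [Finset.card_product, Finset.card_univ, Finset.card_univ, Fintype.card_fin] at this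
  exact_mod_cast this

theorem uniformProb_not_isSeparated_le {n b : ℕ} [NeZero b] (T : ℕ) (S U : Finset (Fin n))
    (hb : 2 * (S.card * U.card) ≤ b) :
    uniformProb (fun h : Fin T → Fin n → Fin b => ¬ IsSeparated h S U) ≤ (1 / 2) ^ T := by
  have hb' : (0 : ℝ) < b := by exact_mod_cast NeZero.pos b
  have h1 : uniformProb (fun h : Fin n → Fin b => ∃ p ∈ S ×ˢ (U \ S), h p.1 = h p.2) ≤ 1 / 2 := by
    refine (uniformProb_exists_finset_le_mul (S ×ˢ (U \ S))
      (fun p (h : Fin n → Fin b) => h p.1 = h p.2) (ε := 1 / b) fun p hp => ?_).trans ?_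
    · refine uniformProb_apply_eq_le fun hxy => ?_
      rw [Finset.mem_product, Finset.mem_sdiff] at hp
      exact hp.2.2 (hxy ▸ hp.1)
    · rw [Finset.card_product, mul_one_div, div_le_div_iff₀ hb' two_pos, one_mul]
      have := Nat.mul_le_mul_left S.card (Finset.card_le_card (Finset.sdiff_subset (s := U) (t := S)))
      exact_mod_cast (by omega : S.card * (U \ S).card * 2 ≤ b)
  have h2 := uniformProb_forall_mem_le (Finset.univ : Finset (Fin T))
    (fun _ (h : Fin n → Fin b) => ∃ p ∈ S ×ˢ (U \ S), h p.1 = h p.2) fun _ _ => h1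
  rw [Finset.card_univ, Fintype.card_fin] at h2
  refine (uniformProb_mono fun h hh t _ => ?_).trans h2
  by_contra hcon
  push Not at hcon
  exact hh ⟨t, fun x hx y hy => hcon (x, y) (Finset.mem_product.mpr ⟨hx, hy⟩)⟩

theorem uniformProb_val_lt_two_pow {J j : ℕ} (hj : j ≤ J) :
    uniformProb (fun y : Fin (2 ^ J) => (y : ℕ) < 2 ^ (J - j)) = 1 / 2 ^ j := by
  rw [uniformProb_eq_card_div, Fin.card_filter_val_lt, Fintype.card_fin,
    min_eq_right (Nat.pow_le_pow_right two_pos (Nat.sub_le J j))]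
  push_cast
  rw [div_eq_div_iff (by positivity) (by positivity), ← pow_add, Nat.sub_add_cancel hj, one_mul]

/-- If `B` is small, level 0 keeps everything. Otherwise the level `j = log₂(|B|/a)` has between `a`
and `2a` expected survivors. No survivors has probability at most `exp(-a)`, and so has reaching
`5a`, by Chernoff with exponent `2·2a - 5a`. -/
theorem uniformProb_not_hasGoodLevel_le {n J : ℕ} {a : ℕ} (ha : 1 ≤ a)
    (B : Finset (Finset (Fin n))) (hB : 1 ≤ B.card) (hBJ : B.card ≤ 2 ^ J) :
    uniformProb (fun ρ : Finset (Fin n) → Fin (2 ^ J) => ¬ HasGoodLevel (5 * a) ρ B)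
      ≤ 2 * Real.exp (-a) := by
  by_cases hsmall : B.card ≤ 5 * a
  · refine le_trans (le_of_eq ?_) (by positivity : (0 : ℝ) ≤ 2 * Real.exp (-a))
    rw [uniformProb, div_eq_zero_iff]
    refine Or.inl (Finset.sum_eq_zero fun ρ _ => if_neg (not_not.mpr ⟨0, ?_⟩))
    have : (B.filter fun S => (ρ S : ℕ) < 2 ^ (J - ((0 : Fin (J + 1)) : ℕ))) = B :=
      Finset.filter_true_of_mem fun S _ => by simp
    rw [this]
    exact ⟨hB, hsmall⟩
  push Not at hsmall
  set j := Nat.log 2 (B.card / a) with hj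
  have hdiv : B.card / a ≠ 0 := (Nat.div_pos (by omega) ha).ne'
  have hlow : 2 ^ j * a ≤ B.card :=
    (Nat.le_div_iff_mul_le ha).mp (Nat.pow_log_le_self 2 hdiv)
  have hhigh : B.card < 2 * 2 ^ j * a := by
    have := Nat.lt_pow_succ_log_self one_lt_two (B.card / a)
    rw [pow_succ, mul_comm] at this
    exact (Nat.div_lt_iff_lt_mul ha).mp this
  have hjJ : j ≤ J := by
    refine (Nat.pow_le_pow_iff_right one_lt_two).mp (le_trans ?_ hBJ)
    exact (Nat.le_mul_of_pos_right _ ha).trans hlow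
  have hp := uniformProb_val_lt_two_pow hjJ
  have h2j : (0 : ℝ) < 2 ^ j := by positivity
  have hlow' : (a : ℝ) ≤ 1 / 2 ^ j * B.card := by
    rw [one_div, ← div_eq_inv_mul, le_div_iff₀ h2j, mul_comm]
    exact_mod_cast hlow
  have hhigh' : 1 / 2 ^ j * (B.card : ℝ) ≤ 2 * a := by
    rw [one_div, ← div_eq_inv_mul, div_le_iff₀ h2j]
    have : (B.card : ℝ) ≤ 2 * 2 ^ j * a := by exact_mod_cast hhigh.le
    linarith
  have h1 : uniformProb (fun ρ : Finset (Fin n) → Fin (2 ^ J) =>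
      ∀ S ∈ B, ¬ (ρ S : ℕ) < 2 ^ (J - j)) ≤ Real.exp (-a) := by
    refine (uniformProb_forall_mem_le B (fun _ (y : Fin (2 ^ J)) => ¬ (y : ℕ) < 2 ^ (J - j))
      (ε := Real.exp (-(1 / 2 ^ j))) fun _ _ => ?_).trans ?_
    · rw [uniformProb_not, hp]
      linarith [Real.add_one_le_exp (-(1 / 2 ^ j : ℝ))]
    · rw [← Real.exp_nat_mul]
      exact Real.exp_le_exp.mpr (by linarith)
  have h2 : uniformProb (fun ρ : Finset (Fin n) → Fin (2 ^ J) => ((5 * a : ℕ) : ℝ)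
      ≤ ((B.filter fun S => (ρ S : ℕ) < 2 ^ (J - j)).card : ℝ)) ≤ Real.exp (-a) := by
    refine (uniformProb_card_filter_gt_le B (fun _ (y : Fin (2 ^ J)) => (y : ℕ) < 2 ^ (J - j))
      fun _ _ => hp.le).trans (Real.exp_le_exp.mpr ?_)
    push_cast
    linarith
  refine (uniformProb_mono (q := fun ρ => (∀ S ∈ B, ¬ (ρ S : ℕ) < 2 ^ (J - j)) ∨
    ((5 * a : ℕ) : ℝ) ≤ ((B.filter fun S => (ρ S : ℕ) < 2 ^ (J - j)).card : ℝ))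
    fun ρ hρ => ?_).trans ((uniformProb_or_le _ _).trans (by linarith))
  by_contra hcon
  push Not at hcon
  obtain ⟨⟨S, hS, hSj⟩, hlt⟩ := hcon
  refine hρ ⟨⟨j, Nat.lt_succ_of_le hjJ⟩, Finset.card_pos.mpr ⟨S, ?_⟩, ?_⟩
  · exact Finset.mem_filter.mpr ⟨hS, hSj⟩
  · exact_mod_cast hlt.le

theorem uniformProb_not_decodesCells_le {n b T J w q d s : ℕ} [NeZero q]
    (M : Multiset (Finset (Fin n))) (ρ : Finset (Fin n) → Fin (2 ^ J))
    (h : Fin T → Fin n → Fin b) :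
    uniformProb (fun A : Fin w → Finset (Fin n) → ZMod q => ¬ DecodesCells d s M (ρ, h, A))
      ≤ Fintype.card (SketchCell b T J d) *
        (Fintype.card {S : Finset (Fin n) // S.card ≤ d} * q) ^ s * (1 / 2) ^ w := by
  have := uniformProb_exists_le_mul (Ω := Fin w → Finset (Fin n) → ZMod q)
    (ι := SketchCell b T J d × (Fin s → {S : Finset (Fin n) // S.card ≤ d} × ZMod q))
    (fun p A => (∀ r, ∑ R, A r R * (sparseVector p.2 R - cellVector q ρ h M p.1 R) = 0) ∧
      sparseVector p.2 ≠ cellVector q ρ h M p.1) (ε := (1 / 2) ^ w) fun p => by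
      by_cases hp : sparseVector p.2 = cellVector q ρ h M p.1
      · refine le_trans (le_of_eq ?_) (by positivity : (0 : ℝ) ≤ (1 / 2) ^ w)
        rw [uniformProb, div_eq_zero_iff]
        exact Or.inl (Finset.sum_eq_zero fun A _ => if_neg fun hA => hA.2 hp)
      · exact (uniformProb_mono fun A hA => hA.1).trans
          (uniformProb_forall_sum_mul_eq_zero_le w (sub_ne_zero.mpr hp))
  rw [Fintype.card_prod (SketchCell b T J d), Fintype.card_fun, Fintype.card_fin,
    Fintype.card_prod {S : Finset (Fin n) // S.card ≤ d}, ZMod.card] at this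
  rw [Nat.cast_mul, Nat.cast_pow, Nat.cast_mul] at this
  refine (uniformProb_mono fun A hA => ?_).trans this
  unfold DecodesCells at hA
  push Not at hA
  obtain ⟨c, f, h1, h2⟩ := hA
  exact ⟨(c, f), h1, h2⟩

/-- The probability that the solution computed from the sketch is not optimal. -/
theorem uniformProb_not_isOptimalSolution_le {φ : ℕ → Prop} [DecidablePred φ]
    (hφ : IsCoverageCriterion φ) {n m k b T J w q d a : ℕ} [NeZero q] [NeZero b]
    (hq : m < q) (hJ : m ≤ 2 ^ J) (ha : 1 ≤ a) (hb : 2 * (k * d ^ 2) ≤ b)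
    (M : Multiset (Finset (Fin n))) (hM : M.card ≤ m) (hd : ∀ S ∈ M, S.card ≤ d) :
    uniformProb (fun ω : SketchSeed n b T J w q => ¬ IsOptimalSolution (countingValue φ) k M
      (bestSubset (countingValue φ) k (sketchKernel (5 * a) ω (M.map (cellSketch d ω)).sum)))
      ≤ Fintype.card (SketchCell b T J d) *
          (Fintype.card {S : Finset (Fin n) // S.card ≤ d} * q) ^ (5 * a) * (1 / 2) ^ w
        + m * T * (2 * Real.exp (-a)) + k * (1 / 2) ^ T := by
  -- The solution is a function of the priorities alone, so fixing them leaves the colourings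
  -- uniform.
  choose C hC hmin using fun ρ : Finset (Fin n) → Fin (2 ^ J) =>
    exists_finset_isOptimalSolution_rank_minimal hφ k M fun S => (ρ S : ℕ)
  have hMcard : (M.toFinset.card : ℝ) ≤ m := by
    exact_mod_cast (Multiset.toFinset_card_le M).trans hM
  refine (uniformProb_mono (q := fun ω : SketchSeed n b T J w q =>
    (¬ DecodesCells d (5 * a) M ω ∨
      ∃ p ∈ M.toFinset ×ˢ (Finset.univ : Finset (Fin T)),
        ¬ HasGoodLevel (5 * a) ω.1 (bucket M (ω.2.1 p.2) p.1)) ∨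
      ∃ S ∈ C ω.1, ¬ IsSeparated ω.2.1 S ((C ω.1).biUnion id)) fun ω hω => ?_).trans ?_
  · by_contra hcon
    push Not at hcon
    obtain ⟨⟨h1, h2⟩, h3⟩ := hcon
    exact hω (isOptimalSolution_of_sketch hd (hM.trans_lt hq) h1
      (fun S hS t => h2 (S, t) (Finset.mem_product.mpr ⟨hS, Finset.mem_univ t⟩))
      (hC ω.1) (hmin ω.1) h3)
  refine (uniformProb_or_le _ _).trans (add_le_add ((uniformProb_or_le _ _).trans
    (add_le_add ?_ ?_)) ?_)
  · refine uniformProb_prod_le_of_left (by positivity) fun ρ =>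
      uniformProb_prod_le_of_left (by positivity) fun h =>
        uniformProb_not_decodesCells_le M ρ h
  -- Buckets depend only on `M` and the colourings; with these fixed, the priorities are uniform.
  · refine uniformProb_prod_le_of_right (by positivity) fun hA => ?_
    refine (uniformProb_exists_finset_le_mul (M.toFinset ×ˢ (Finset.univ : Finset (Fin T)))
      (fun p (ρ : Finset (Fin n) → Fin (2 ^ J)) =>
        ¬ HasGoodLevel (5 * a) ρ (bucket M (hA.1 p.2) p.1)) (ε := 2 * Real.exp (-a))
        fun p hp => ?_).trans ?_
    · have hp1 := (Finset.mem_product.mp hp).1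
      refine uniformProb_not_hasGoodLevel_le ha _ (Finset.card_pos.mpr ⟨p.1, ?_⟩) ?_
      · exact Finset.mem_filter.mpr ⟨hp1, rfl, rfl⟩
      · exact (Finset.card_filter_le _ _).trans
          ((Multiset.toFinset_card_le M).trans (hM.trans hJ))
    · rw [Finset.card_product, Finset.card_univ, Fintype.card_fin]
      push_cast
      gcongr
  · refine uniformProb_prod_le_of_left (by positivity) fun ρ =>
      uniformProb_prod_le_of_right (by positivity) fun _ => ?_
    have hCM : ∀ S ∈ C ρ, S.card ≤ d := fun S hS => hd S (Multiset.subset_of_le (hC ρ).1 hS)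
    have hCk : (C ρ).card ≤ k := (hC ρ).2.1
    refine (uniformProb_exists_finset_le_mul (C ρ) (fun S (h : Fin T → Fin n → Fin b) =>
      ¬ IsSeparated h S ((C ρ).biUnion id)) (ε := (1 / 2) ^ T) fun S hS => ?_).trans ?_
    · refine uniformProb_not_isSeparated_le T S _ (le_trans ?_ hb)
      have h1 : ((C ρ).biUnion id).card ≤ k * d :=
        (Finset.card_biUnion_le_card_mul _ _ d hCM).trans (Nat.mul_le_mul_right d hCk)
      calc 2 * (S.card * ((C ρ).biUnion id).card) ≤ 2 * (d * (k * d)) := by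
            gcongr; exact hCM S hS
        _ = 2 * (k * d ^ 2) := by ring
    · gcongr

end SketchProbability

/-! ### Choice of parameters and the space bound -/

section Parameters

theorem card_subtype_card_le (b d : ℕ) :
    Fintype.card {P : Finset (Fin b) // P.card ≤ d} ≤ ∑ i ∈ Finset.range (d + 1), b.choose i := by
  classical
  rw [Fintype.card_subtype]
  refine (Finset.card_le_card (t := (Finset.range (d + 1)).biUnion fun i =>
    Finset.powersetCard i Finset.univ) fun P hP => ?_).trans
    (Finset.card_biUnion_le.trans (le_of_eq ?_))
  · simpa [Nat.lt_succ_iff, Finset.mem_powersetCard] using hP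
  · simp

theorem card_subtype_card_le_pow (b d : ℕ) :
    Fintype.card {P : Finset (Fin b) // P.card ≤ d} ≤ (b + 1) ^ d := by
  refine (card_subtype_card_le b d).trans ?_
  rw [add_pow]
  refine Finset.sum_le_sum fun i hi => ?_
  rw [one_pow, mul_one]
  exact (Nat.choose_le_pow b i).trans
    (Nat.le_mul_of_pos_right _ (Nat.choose_pos (Nat.lt_succ_iff.mp (Finset.mem_range.mp hi))))

/-- `(dβ choose i) ≤ β^d · d^i / i!`, and the remaining sum is part of the exponential series. -/
theorem card_subtype_card_le_mul_exp {β : ℕ} (hβ : 1 ≤ β) (d : ℕ) :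
    (Fintype.card {P : Finset (Fin (d * β)) // P.card ≤ d} : ℝ) ≤ (β : ℝ) ^ d * Real.exp d := by
  have h1 : (Fintype.card {P : Finset (Fin (d * β)) // P.card ≤ d} : ℝ)
      ≤ ∑ i ∈ Finset.range (d + 1), ((d * β).choose i : ℝ) := by
    exact_mod_cast card_subtype_card_le (d * β) d
  refine h1.trans ?_
  calc _ ≤ ∑ i ∈ Finset.range (d + 1), (β : ℝ) ^ d * ((d : ℝ) ^ i / i.factorial) := by
        refine Finset.sum_le_sum fun i hi => (Nat.choose_le_pow_div (α := ℝ) i (d * β)).trans ?_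
        push_cast
        rw [mul_pow, mul_comm ((d : ℝ) ^ i), mul_div_assoc]
        gcongr
        · exact_mod_cast hβ
        · exact Nat.lt_succ_iff.mp (Finset.mem_range.mp hi)
    _ ≤ _ := by
        rw [← Finset.mul_sum]
        gcongr
        exact Real.sum_le_exp_of_nonneg (by positivity) _

theorem card_sketchCell (b T J d : ℕ) : Fintype.card (SketchCell b T J d)
    = T * ((d + 1) * (Fintype.card {P : Finset (Fin b) // P.card ≤ d} * (J + 1))) := by
  simp only [SketchCell, Fintype.card_prod, Fintype.card_fin]

/-- The number of colourings. -/
def colouringCount (γ l : ℕ) : ℕ := (γ + 1) * l + 4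

/-- The expected number of survivors at the level that is used. -/
def survivorCount (γ l : ℕ) : ℕ := l + colouringCount γ l + 1 + γ * l + 4

/-- The number of linear functionals. -/
def functionalCount (γ l d : ℕ) : ℕ :=
  (l * d + l) * (5 * survivorCount γ l) + (colouringCount γ l + d + d * (l + 2 * d + 2) + l)
    + (γ * l + 4)

/-- The number of bits of the index of the random choices. -/
def seedBits (γ l d : ℕ) : ℕ := l * d + l + γ * l + 2

/-- The number of bits of memory. -/
def memoryBits (γ l k d : ℕ) : ℕ :=
  seedBits γ l d + l * functionalCount γ l d *
    Fintype.card (SketchCell (d * (2 * k * d)) (colouringCount γ l) l d)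

theorem card_sketchCell_le {γ l k d : ℕ} (hk : k ≤ 2 ^ l) :
    Fintype.card (SketchCell (d * (2 * k * d)) (colouringCount γ l) l d)
      ≤ 2 ^ (colouringCount γ l + d + d * (l + 2 * d + 2) + l) := by
  have hT : colouringCount γ l ≤ 2 ^ colouringCount γ l := Nat.lt_two_pow_self.le
  have hd : d + 1 ≤ 2 ^ d := Nat.lt_two_pow_self
  have hl : l + 1 ≤ 2 ^ l := Nat.lt_two_pow_self
  have hb : d * (2 * k * d) + 1 ≤ 2 ^ (l + 2 * d + 2) := by
    have h1 : d * (2 * k * d) ≤ 2 ^ d * (2 * 2 ^ l * 2 ^ d) := by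
      gcongr <;> omega
    have h2 : 2 ^ (l + 2 * d + 2) = 2 * (2 ^ d * (2 * 2 ^ l * 2 ^ d)) := by ring
    have h3 : 1 ≤ 2 ^ d * (2 * 2 ^ l * 2 ^ d) := Nat.one_le_iff_ne_zero.mpr (by positivity)
    omega
  have hP : Fintype.card {P : Finset (Fin (d * (2 * k * d))) // P.card ≤ d}
      ≤ 2 ^ (d * (l + 2 * d + 2)) := by
    refine (card_subtype_card_le_pow _ d).trans ?_
    rw [mul_comm d (l + 2 * d + 2), pow_mul]
    exact Nat.pow_le_pow_left hb d
  rw [card_sketchCell]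
  calc _ ≤ 2 ^ colouringCount γ l * (2 ^ d * (2 ^ (d * (l + 2 * d + 2)) * 2 ^ l)) := by gcongr
    _ = _ := by rw [pow_add, pow_add, pow_add]; ring

/-- The three counts are chosen so that each term is at most `2^-(γl+4)`: `T` absorbs `k`, then `a`
absorbs `2mT`, then `w` absorbs the number of pairs of a cell and a sparse vector. -/
theorem sketch_failure_le {γ l n m k d : ℕ} (hl : n + m + 2 ≤ 2 ^ l) (hkm : k ≤ m) :
    (Fintype.card (SketchCell (d * (2 * k * d)) (colouringCount γ l) l d) : ℝ) *
          (Fintype.card {S : Finset (Fin n) // S.card ≤ d} * (m + 1 : ℕ)) ^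
            (5 * survivorCount γ l) * (1 / 2) ^ functionalCount γ l d
        + m * colouringCount γ l * (2 * Real.exp (-survivorCount γ l))
        + k * (1 / 2) ^ colouringCount γ l ≤ (1 / 2) ^ (γ * l + 2) := by
  have hm : (m : ℝ) ≤ 2 ^ l := by exact_mod_cast (by omega : m ≤ 2 ^ l)
  have hk : (k : ℝ) ≤ 2 ^ l := by exact_mod_cast (by omega : k ≤ 2 ^ l)
  have h1 : (Fintype.card (SketchCell (d * (2 * k * d)) (colouringCount γ l) l d) : ℝ) *
      (Fintype.card {S : Finset (Fin n) // S.card ≤ d} * (m + 1 : ℕ)) ^ (5 * survivorCount γ l) *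
      (1 / 2) ^ functionalCount γ l d ≤ (1 / 2) ^ (γ * l + 4) := by
    have hc : (Fintype.card (SketchCell (d * (2 * k * d)) (colouringCount γ l) l d) : ℝ)
        ≤ 2 ^ (colouringCount γ l + d + d * (l + 2 * d + 2) + l) := by
      exact_mod_cast card_sketchCell_le (by omega)
    have hX : (Fintype.card {S : Finset (Fin n) // S.card ≤ d} : ℝ) * (m + 1 : ℕ)
        ≤ 2 ^ (l * d + l) := by
      have : Fintype.card {S : Finset (Fin n) // S.card ≤ d} * (m + 1) ≤ 2 ^ (l * d + l) := by
        rw [pow_add, pow_mul]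
        exact Nat.mul_le_mul ((card_subtype_card_le_pow n d).trans
          (Nat.pow_le_pow_left (by omega) d)) (by omega)
      exact_mod_cast this
    calc _ ≤ (2 : ℝ) ^ (colouringCount γ l + d + d * (l + 2 * d + 2) + l) *
          (2 ^ (l * d + l)) ^ (5 * survivorCount γ l) * (1 / 2) ^ functionalCount γ l d := by
          gcongr
      _ = _ := by
          rw [functionalCount, pow_add (1 / 2 : ℝ) _ (γ * l + 4), ← mul_assoc, ← pow_mul,
            ← pow_add, add_comm (_ + l), ← mul_pow]
          norm_num
  have h2 : (m : ℝ) * colouringCount γ l * (2 * Real.exp (-survivorCount γ l))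
      ≤ (1 / 2) ^ (γ * l + 4) := by
    have hT : (colouringCount γ l : ℝ) ≤ 2 ^ colouringCount γ l := by
      exact_mod_cast Nat.lt_two_pow_self.le
    have he : Real.exp (-survivorCount γ l) ≤ (1 / 2) ^ survivorCount γ l := by
      rw [Real.exp_neg, one_div, inv_pow]
      gcongr
      rw [← mul_one ((survivorCount γ l : ℕ) : ℝ), Real.exp_nat_mul]
      gcongr
      linarith [Real.add_one_le_exp 1]
    calc _ ≤ (2 : ℝ) ^ l * 2 ^ colouringCount γ l * (2 ^ 1 * (1 / 2) ^ survivorCount γ l) := by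
          rw [pow_one]
          gcongr
      _ = _ := by
          rw [survivorCount, add_assoc _ (γ * l) 4, pow_add (1 / 2 : ℝ) _ (γ * l + 4),
            ← mul_assoc, ← mul_assoc, ← pow_add, ← pow_add, ← mul_pow]
          norm_num
  have h3 : (k : ℝ) * (1 / 2) ^ colouringCount γ l ≤ (1 / 2) ^ (γ * l + 4) := by
    calc _ ≤ (2 : ℝ) ^ l * (1 / 2) ^ colouringCount γ l := by gcongr
      _ = _ := by
          rw [colouringCount, (by ring : (γ + 1) * l + 4 = l + (γ * l + 4)), pow_add,
            ← mul_assoc, ← mul_pow]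
          norm_num
  have h4 : (1 / 2 : ℝ) ^ (γ * l + 2) = 4 * (1 / 2) ^ (γ * l + 4) := by
    rw [pow_add, pow_add]; ring
  have h5 : (0 : ℝ) < (1 / 2) ^ (γ * l + 4) := by positivity
  linarith

theorem exists_streamingAlgorithm_memoryBits {φ : ℕ → Prop} [DecidablePred φ]
    (hφ : IsCoverageCriterion φ) {γ l n m k d : ℕ} (hl : n + m + 2 ≤ 2 ^ l) (hk : 1 ≤ k)
    (hkm : k ≤ m) (hd : 1 ≤ d) :
    ∃ A : StreamingAlgorithm n (memoryBits γ l k d),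
      A.SolvesExactly (countingValue φ) m d k (1 / ((m : ℝ≥0∞) + 1) ^ γ) := by
  set T := colouringCount γ l
  set a := survivorCount γ l with ha
  set w := functionalCount γ l d
  have : NeZero (d * (2 * k * d)) := ⟨by positivity⟩
  have h4ε : ENNReal.ofReal (4 * (1 / 2) ^ (γ * l + 2)) ≤ 1 / ((m : ℝ≥0∞) + 1) ^ γ := by
    have h1 : (4 : ℝ) * (1 / 2) ^ (γ * l + 2) = ((2 ^ l) ^ γ)⁻¹ := by
      rw [pow_add, ← pow_mul, mul_comm l γ, one_div, inv_pow]; ring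
    have h2 : ((m : ℝ≥0∞) + 1) ^ γ = ENNReal.ofReal ((m + 1) ^ γ) := by
      rw [ENNReal.ofReal_pow (by positivity), ENNReal.ofReal_add (by positivity) zero_le_one]
      simp
    rw [h1, h2, one_div, ← ENNReal.ofReal_inv_of_pos (by positivity)]
    refine ENNReal.ofReal_le_ofReal ?_
    gcongr
    exact_mod_cast (by omega : m + 1 ≤ 2 ^ l)
  obtain ⟨A, hA⟩ := exists_streamingAlgorithm_of_sketch (k := k) (m := m) (d := d)
    (countingValue φ)
    (Ω := SketchSeed n (d * (2 * k * d)) T l w (m + 1))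
    (G := SketchCell (d * (2 * k * d)) T l d → Fin w → ZMod (m + 1))
    (sketch := cellSketch d)
    (decode := fun ω g => bestSubset (countingValue φ) k (sketchKernel (5 * a) ω g))
    (ε := (1 / 2) ^ (γ * l + 2))
    (fun M hM hMd => (uniformProb_not_isOptimalSolution_le hφ (Nat.lt_succ_self m)
      (by omega) (by rw [ha, survivorCount]; omega) (by nlinarith) M hM hMd).trans
        (sketch_failure_le hl hkm))
    -- With this `L`, `2εL = 2·2^(ld)·2^l`, while at most `(2^l)^(2^(ld))` collections have to be
    -- served.
    (2 ^ seedBits γ l d) (by positivity)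
    (by
      have h1 : Fintype.card {S : Finset (Fin n) // S.card ≤ d} ≤ 2 ^ (l * d) := by
        rw [pow_mul]
        exact (card_subtype_card_le_pow n d).trans (Nat.pow_le_pow_left (by omega) d)
      rw [Fintype.card_subtype] at h1
      have h2 : ((1 / 2 : ℝ)) ^ (γ * l + 2) * (2 ^ seedBits γ l d : ℕ) = 2 ^ (l * d) * 2 ^ l := by
        rw [seedBits, add_assoc _ (γ * l) 2, Nat.cast_pow, pow_add _ _ (γ * l + 2), mul_comm,
          mul_assoc, Nat.cast_two, ← mul_pow, pow_add]
        norm_num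
      have hll : (l : ℝ) ≤ 2 ^ l := by exact_mod_cast Nat.lt_two_pow_self.le
      rw [mul_assoc, h2]
      calc _ ≤ ((2 : ℝ) ^ l) ^ (2 ^ (l * d)) := by
            refine (pow_le_pow_left₀ (by positivity) (?_ : (m : ℝ) + 1 ≤ 2 ^ l) _).trans
              (pow_le_pow_right₀ (one_le_pow₀ one_le_two) h1)
            exact_mod_cast (by omega : m + 1 ≤ 2 ^ l)
        _ = 2 ^ (l * 2 ^ (l * d)) := (pow_mul 2 l _).symm
        _ ≤ Real.exp 1 ^ (l * 2 ^ (l * d)) := by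
            gcongr
            linarith [Real.add_one_le_exp 1]
        _ = Real.exp (2 ^ (l * d) * l) := by
            rw [← Real.exp_nat_mul]; push_cast; ring_nf
        _ < _ := by
            refine Real.exp_lt_exp.mpr ?_
            have : (2 : ℝ) ^ (l * d) * l ≤ 2 ^ (l * d) * 2 ^ l := by gcongr
            have h0 : (0 : ℝ) < 2 ^ (l * d) * 2 ^ l := by positivity
            linarith)
    (s := memoryBits γ l k d)
    (by
      rw [Fintype.card_fun, Fintype.card_fun, ZMod.card, Fintype.card_fin, memoryBits, pow_add,
        ← pow_mul, mul_assoc l, pow_mul 2 l]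
      gcongr
      omega)
  exact ⟨A, fun us hus => (hA us hus).trans h4ε⟩

theorem memoryBits_le {γ l k d : ℕ} (hl : 1 ≤ l) (hk : 1 ≤ k) (hd : 1 ≤ d) :
    (memoryBits γ l k d : ℝ)
      ≤ 704 * (γ + 1 : ℝ) ^ 2 * Real.exp 48 * ((d : ℝ) ^ (2 * d) * (k : ℝ) ^ d) * (l : ℝ) ^ 5 := by
  set P := Fintype.card {P : Finset (Fin (d * (2 * k * d))) // P.card ≤ d} with hP
  have hP1 : 1 ≤ P := Fintype.card_pos_iff.mpr ⟨⟨∅, by simp⟩⟩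
  have hg : 1 ≤ γ + 1 := by omega
  have hgl : 1 ≤ (γ + 1) * l := Nat.mul_pos hg hl
  have hT : colouringCount γ l ≤ 5 * ((γ + 1) * l) := by unfold colouringCount; omega
  have ha : survivorCount γ l ≤ 11 * ((γ + 1) * l) := by
    have : (γ + 1) * l = γ * l + l := by ring
    unfold survivorCount; omega
  have hw : functionalCount γ l d ≤ 70 * ((γ + 1) * l ^ 2 * (d + 1) ^ 2) := by
    have h1 : (l * d + l) * (5 * survivorCount γ l)
        ≤ 55 * ((γ + 1) * l ^ 2 * (d + 1) ^ 2) := by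
      calc _ ≤ (l * d + l) * (5 * (11 * ((γ + 1) * l))) := by gcongr
        _ = 55 * ((γ + 1) * l ^ 2 * (d + 1) ^ 1) := by ring
        _ ≤ _ := by gcongr <;> omega
    have h2 : (γ + 1) * l ≤ (γ + 1) * l ^ 2 * (d + 1) ^ 2 := by
      calc _ = (γ + 1) * l ^ 1 * 1 := by ring
        _ ≤ _ := by
          gcongr
          · omega
          · exact Nat.one_le_pow _ _ (by omega)
    have h3 : d ≤ (γ + 1) * l ^ 2 * (d + 1) ^ 2 := by
      calc d ≤ 1 * 1 * (d + 1) ^ 2 := by nlinarith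
        _ ≤ _ := by
          gcongr
          exact Nat.one_le_pow _ _ hl
    have h4 : d * (l + 2 * d + 2) ≤ 3 * ((γ + 1) * l ^ 2 * (d + 1) ^ 2) := by
      calc d * (l + 2 * d + 2) ≤ (d + 1) * (l * (d + 1) + 2 * l * (d + 1)) := by
            have : 2 * d + 2 ≤ 2 * l * (d + 1) := by nlinarith
            have : l ≤ l * (d + 1) := Nat.le_mul_of_pos_right _ (by omega)
            exact Nat.mul_le_mul (by omega) (by omega)
        _ = 3 * (1 * l ^ 1 * (d + 1) ^ 2) := by ring
        _ ≤ _ := by gcongr; omega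
    have h5 : l + (γ * l + 4) ≤ 5 * ((γ + 1) * l) := by
      have : (γ + 1) * l = γ * l + l := by ring
      omega
    unfold functionalCount
    omega
  have hc : Fintype.card (SketchCell (d * (2 * k * d)) (colouringCount γ l) l d)
      ≤ 10 * ((γ + 1) * l ^ 2 * (d + 1) * P) := by
    rw [card_sketchCell, ← hP]
    calc _ ≤ 5 * ((γ + 1) * l) * ((d + 1) * (P * (2 * l))) := by gcongr; omega
      _ = _ := by ring
  have hs : seedBits γ l d ≤ 4 * ((γ + 1) ^ 2 * l ^ 5 * (d + 1) ^ 3 * P) := by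
    calc seedBits γ l d ≤ 4 * ((γ + 1) ^ 1 * l ^ 1 * (d + 1) ^ 1 * 1) := by
          unfold seedBits
          have : (γ + 1) ^ 1 * l ^ 1 * (d + 1) ^ 1 * 1 = γ * l * d + γ * l + l * d + l := by ring
          have := Nat.zero_le (γ * l * d)
          omega
      _ ≤ _ := by gcongr <;> omega
  have hnat : memoryBits γ l k d ≤ 704 * ((γ + 1) ^ 2 * l ^ 5 * (d + 1) ^ 3 * P) := by
    unfold memoryBits
    calc _ ≤ 4 * ((γ + 1) ^ 2 * l ^ 5 * (d + 1) ^ 3 * P)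
          + l * (70 * ((γ + 1) * l ^ 2 * (d + 1) ^ 2)) * (10 * ((γ + 1) * l ^ 2 * (d + 1) * P)) := by
          gcongr
      _ = _ := by ring
  have hreal : ((d : ℝ) + 1) ^ 3 * P ≤ Real.exp 48 * ((d : ℝ) ^ (2 * d) * (k : ℝ) ^ d) := by
    have h1 : (P : ℝ) ≤ (2 * k * d) ^ d * Real.exp d := by
      have := card_subtype_card_le_mul_exp (β := 2 * k * d) (Nat.mul_pos (by omega) hd) d
      push_cast at this
      exact this
    have h2 : ((d : ℝ) + 1) ^ 3 ≤ 8 ^ d := by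
      have : (d : ℝ) + 1 ≤ 2 ^ d := by
        exact_mod_cast (Nat.lt_two_pow_self : d < 2 ^ d)
      calc _ ≤ ((2 : ℝ) ^ d) ^ 3 := by gcongr
        _ = _ := by rw [← pow_mul, mul_comm, pow_mul]; norm_num
    have h3 : Real.exp d ≤ 3 ^ d := by
      rw [← mul_one (d : ℝ), Real.exp_nat_mul]
      gcongr
      linarith [Real.exp_one_lt_d9]
    -- Here `48 = 8·2·3` collects the bases from `(d+1)^3`, from `2kd` and from `exp d`; the term
    -- `48^d/d!` of the series of `exp 48` trades `48^d` for the second `d^d`.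
    have h4 : (48 : ℝ) ^ d ≤ Real.exp 48 * d ^ d := by
      have h5 := Real.pow_div_factorial_le_exp 48 (by norm_num) d
      rw [div_le_iff₀ (by positivity)] at h5
      refine h5.trans ?_
      gcongr
      exact_mod_cast Nat.factorial_le_pow d
    calc _ ≤ (8 : ℝ) ^ d * ((2 * k * d) ^ d * 3 ^ d) := by gcongr; exact h1.trans (by gcongr)
      _ = 48 ^ d * ((k : ℝ) ^ d * d ^ d) := by
          rw [← mul_pow, ← mul_pow, ← mul_pow, ← mul_pow]; ring
      _ ≤ Real.exp 48 * d ^ d * ((k : ℝ) ^ d * d ^ d) := by gcongr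
      _ = _ := by rw [two_mul, pow_add]; ring
  calc (memoryBits γ l k d : ℝ) ≤ 704 * ((γ + 1 : ℝ) ^ 2 * (l : ℝ) ^ 5 * (d + 1) ^ 3 * P) := by
        exact_mod_cast hnat
    _ = 704 * (γ + 1 : ℝ) ^ 2 * (l : ℝ) ^ 5 * ((d + 1) ^ 3 * P) := by ring
    _ ≤ 704 * (γ + 1 : ℝ) ^ 2 * (l : ℝ) ^ 5
        * (Real.exp 48 * ((d : ℝ) ^ (2 * d) * (k : ℝ) ^ d)) := by gcongr
    _ = _ := by ring

theorem clog_two_le_three_mul_log {x : ℕ} (hx : 3 ≤ x) :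
    (Nat.clog 2 x : ℝ) ≤ 3 * Real.log x := by
  have hx' : (3 : ℝ) ≤ x := by exact_mod_cast hx
  have h1 : 1 ≤ Real.log x := by
    rw [Real.le_log_iff_exp_le (by linarith)]
    linarith [Real.exp_one_lt_d9]
  have h2 : ((Nat.clog 2 x).pred : ℝ) * Real.log 2 ≤ Real.log x := by
    rw [← Real.log_pow]
    refine Real.log_le_log (by positivity) ?_
    exact_mod_cast (Nat.pow_pred_clog_lt_self one_lt_two (by omega)).le
  have h3 : (Nat.clog 2 x : ℝ) ≤ (Nat.clog 2 x).pred + 1 := by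
    exact_mod_cast (by rw [Nat.pred_eq_sub_one]; omega :
      Nat.clog 2 x ≤ (Nat.clog 2 x).pred + 1)
  have h4 : (0 : ℝ) ≤ (Nat.clog 2 x).pred := by positivity
  nlinarith [Real.log_two_gt_d9]

/-- With `d = 0` there would be no colours, so this case is separate: only empty sets occur, and
choosing none of them is optimal. -/
theorem exists_streamingAlgorithm_of_size_zero {φ : ℕ → Prop} [DecidablePred φ]
    (hφ : IsCoverageCriterion φ) (n m k : ℕ) (δ : ℝ≥0∞) :
    ∃ A : StreamingAlgorithm n 0, A.SolvesExactly (countingValue φ) m 0 k δ := by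
  refine ⟨⟨PMF.pure default, fun σ _ => PMF.pure σ, fun _ => PMF.pure 0⟩, fun us hus => ?_⟩
  obtain ⟨-, h2⟩ := IsValidStreamFrom.card_le_and_card_le us 0 hus (by simp) (by simp)
  have hopt : IsOptimalSolution (countingValue φ) k (finalCollection us) 0 := by
    refine ⟨Multiset.zero_le _, by simp, fun C hC _ => le_trans (le_of_eq ?_) (Nat.zero_le _)⟩
    rw [countingValue, Finset.card_eq_zero, Finset.filter_eq_empty_iff]
    intro x _
    have : C.countP (fun S => x ∈ S) = 0 := by
      rw [Multiset.countP_eq_zero]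
      intro S hS
      have := h2 S (Multiset.subset_of_le hC hS)
      rw [Finset.card_eq_zero.mp (Nat.le_zero.mp this)]
      simp
    rw [this]
    exact hφ.not_zero
  refine le_of_eq_of_le ?_ (zero_le (a := δ))
  rw [PMF.toOuterMeasure_apply_eq_zero_iff, Set.disjoint_left]
  intro C hC
  obtain ⟨σ, -, hσ⟩ := (PMF.mem_support_bind_iff _ _ _).mp hC
  rw [PMF.mem_support_pure_iff] at hσ
  subst hσ
  exact not_not.mpr hopt

end Parameters

theorem mainTheorem5 :
    ∀ γ : ℕ, ∃ (K : ℝ) (e : ℕ), ∀ n m k d : ℕ, 1 ≤ k → k ≤ m →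
      ∃ s : ℕ,
        (s : ℝ) ≤ K * ((d : ℝ) ^ (2 * d) * (k : ℝ) ^ d) * Real.log ((n : ℝ) + m + 2) ^ e ∧
        (∃ A : StreamingAlgorithm n s,
          A.SolvesExactly coverage m d k (1 / ((m : ℝ≥0∞) + 1) ^ γ)) ∧
        (∃ A : StreamingAlgorithm n s,
          A.SolvesExactly uniqueCoverage m d k (1 / ((m : ℝ≥0∞) + 1) ^ γ)) := by
  intro γ
  refine ⟨704 * (γ + 1 : ℝ) ^ 2 * Real.exp 48 * 3 ^ 5, 5, fun n m k d hk hkm => ?_⟩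
  rw [coverage_eq_countingValue, uniqueCoverage_eq_countingValue]
  have hcast : ((n + m + 2 : ℕ) : ℝ) = (n : ℝ) + m + 2 := by push_cast; ring
  have hclog := clog_two_le_three_mul_log (x := n + m + 2) (by omega)
  rw [hcast] at hclog
  have hlog : 0 ≤ Real.log ((n : ℝ) + m + 2) := by
    linarith [(Nat.clog 2 (n + m + 2)).cast_nonneg (α := ℝ)]
  rcases Nat.eq_zero_or_pos d with rfl | hd
  · refine ⟨0, by rw [Nat.cast_zero]; positivity,
      exists_streamingAlgorithm_of_size_zero isCoverageCriterion_one_le n m k _,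
      exists_streamingAlgorithm_of_size_zero isCoverageCriterion_eq_one n m k _⟩
  · have hl := Nat.le_pow_clog one_lt_two (n + m + 2)
    refine ⟨memoryBits γ (Nat.clog 2 (n + m + 2)) k d, ?_,
      exists_streamingAlgorithm_memoryBits isCoverageCriterion_one_le hl hk hkm hd,
      exists_streamingAlgorithm_memoryBits isCoverageCriterion_eq_one hl hk hkm hd⟩
    refine (memoryBits_le (Nat.clog_pos one_lt_two (by omega)) hk hd).trans ?_
    calc _ ≤ 704 * (γ + 1 : ℝ) ^ 2 * Real.exp 48 * ((d : ℝ) ^ (2 * d) * (k : ℝ) ^ d)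
          * (3 * Real.log ((n : ℝ) + m + 2)) ^ 5 := by gcongr
      _ = _ := by ring
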